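/- Let $\Gamma$ be a divisible (totally) ordered abelian group, let $\mathbb{T}_{\max}=(\Gamma\cup\{\bot\},\max,+)$ be the tropical semifield over $\Gamma$, with zero $\mathbb{0}=\bot$, and let $\mathbb{S}_{\max}$ be the symmetrized tropical semiring over $\Gamma$, that is the quotient of the semiring $\mathbb{T}_{\max}^2$ of pairs, with $$(a_1,a_2)\oplus(b_1,b_2)=(a_1\oplus b_1,a_2\oplus b_2),\qquad (a_1,a_2)\odot(b_1,b_2)=(a_1b_1\oplus a_2b_2,\ a_1b_2\oplus a_2b_1),$$ by the congruence that identifies $(a_1,a_2)$ and $(b_1,b_2)$ if they are equal, or if $a_1\ne a_2$, $b_1\ne b_2$ and $a_1\oplus b_2=a_2\oplus b_1$. Write $\ominus$ for the operation induced by $(a_1,a_2)\mapsto(a_2,a_1)$, $|\cdot|:\mathbb{S}_{\max}\to\mathbb{T}_{\max}$ for the map induced by $(a_1,a_2)\mapsto a_1\oplus a_2$, and identify $c\in\mathbb{T}_{\max}$ with the class of $(c,\bot)$. An element is signed if it is $c$ or $\ominus c$ for some $c\in\mathbb{T}_{\max}$; the set of signed elements is $\mathbb{S}_{\max}^\vee$.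 Write $a\,\nabla\,b$ if $a\ominus b$ is the class of a pair $(c,c)$; for polynomials $\nabla$ is meant coefficientwise. Let $P=\bigoplus_{k=m}^{n}P_k\mathsf{Y}^k$ be a nonzero formal polynomial with coefficients in $\mathbb{S}_{\max}^\vee$, of degree $n$ and lower degree $m$. Its polynomial function is $\widehat P:\mathbb{S}_{\max}\to\mathbb{S}_{\max}$, and a root of $P$ is an element $r\in\mathbb{S}_{\max}^\vee$ with $\widehat P(r)\,\nabla\,\mathbb{0}$. The multiplicity $\mathrm{mult}_r(P)$ is defined recursively: it is $0$ if $r$ is not a root of $P$, and otherwise it is $1+\max \mathrm{mult}_r(Q)$, over all formal polynomials $Q$ with coefficients in $\mathbb{S}_{\max}^\vee$ such that $\lambda P\,\nabla\,(\mathsf{Y}\ominus r)Q$ for some $\lambda\in\mathbb{S}_{\max}^\vee\setminus\{\mathbb{0}\}$. A factorization of $\widehat P$ is a multiset $\{s_1,\dots,s_n\}$ of elements of $\mathbb{S}_{\max}^\vee$ such that $\widehat P(y)=P_n\odot(y\ominus s_1)\odot\cdots\odot(y\ominus s_n)$ for all $y\in\mathbb{S}_{\max}$. Let $|P|=\bigoplus_k|P_k|\mathsf{Y}^k$.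 A nonzero corner of $|P|$ is a $c\in\mathbb{T}_{\max}\setminus\{\mathbb{0}\}$ at which the maximum $\bigoplus_k|P_k|c^k$ is attained by at least two different monomials of $|P|$. Assume that $|P|$ is factored, that is $|P|=|P_n|(\mathsf{Y}\oplus c_1)\cdots(\mathsf{Y}\oplus c_n)$ as formal polynomials, for some $c_1,\dots,c_n\in\mathbb{T}_{\max}$. Then there are unique $r_1,\dots,r_n\in\mathbb{S}_{\max}^\vee$ such that $r_i\odot P_{n-i+1}=\ominus P_{n-i}$ for $i\le n-m$ and $r_i=\mathbb{0}$ for $n-m<i\le n$, and the following two conditions are equivalent: (a) all the $r_i$ with the same modulus $|r_i|$ are equal; (b) for each corner $c\neq\mathbb{0}$ of $|P|$, $c$ and $\ominus c$ are not both roots of $P$. If they hold, then $r_1,\dots,r_n$ is a factorization of $\widehat P$, it is the only one (up to reordering) when $\Gamma$ is non-trivial, and for every root $r$ of $P$ the multiplicity $\mathrm{mult}_r(P)$ is the number of occurrences of $r$ in this factorization, that is the number of indices $i$ with $r_i=r$. -/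

import Mathlib

open Polynomial

/-! ### The tropical semifield over an ordered abelian group -/

/-- The tropical semifield `(Γ ∪ {⊥}, max, +)`. Its order is that of `WithBot Γ`; below, semiring
notation is used, so that `0` is `⊥`, `1` is the zero of `Γ`, `a + b` is `max a b`, and `a * b` is
the sum of `a` and `b` in `Γ ∪ {⊥}`. -/
def Tmax (Γ : Type*) : Type _ := WithBot Γ

namespace Tmax

variable {Γ : Type*} [AddCommGroup Γ] [LinearOrder Γ] [IsOrderedAddMonoid Γ]

instance : LinearOrder (Tmax Γ) := inferInstanceAs (LinearOrder (WithBot Γ))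

instance : Zero (Tmax Γ) := ⟨(⊥ : WithBot Γ)⟩
instance : One (Tmax Γ) := ⟨((0 : Γ) : WithBot Γ)⟩
instance : Add (Tmax Γ) := ⟨fun a b => max a b⟩
instance : Mul (Tmax Γ) :=
  ⟨fun a b => ((show WithBot Γ from a) + (show WithBot Γ from b) : WithBot Γ)⟩

instance : CommSemiring (Tmax Γ) where
  add_assoc a b c := max_assoc (α := WithBot Γ) a b c
  add_comm a b := max_comm (α := WithBot Γ) a b
  zero_add a := bot_sup_eq (α := WithBot Γ) a
  add_zero a := sup_bot_eq (α := WithBot Γ) a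
  mul_assoc a b c := add_assoc (G := WithBot Γ) a b c
  mul_comm a b := add_comm (G := WithBot Γ) a b
  one_mul a := zero_add (M := WithBot Γ) a
  mul_one a := add_zero (M := WithBot Γ) a
  zero_mul a := WithBot.bot_add (α := Γ) a
  mul_zero a := WithBot.add_bot (α := Γ) a
  left_distrib a b c := (max_add_add_left (α := WithBot Γ) a b c).symm
  right_distrib a b c := (max_add_add_right (α := WithBot Γ) a b c).symm
  nsmul := nsmulRec
  npow := npowRec

theorem add_def (a b : Tmax Γ) : a + b = max a b := rfl

theorem zero_le (a : Tmax Γ) : 0 ≤ a := bot_le (α := WithBot Γ) (a := a)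

theorem mul_lt_mul_right' {a b c : Tmax Γ} (h : a < b) (hc : 0 < c) : a * c < b * c := by
  change WithBot Γ at a b c
  have hc' : c ≠ ⊥ := ne_of_gt (show (⊥ : WithBot Γ) < c from hc)
  exact WithBot.add_lt_add_right hc' h

theorem mul_lt_mul_left' {a b c : Tmax Γ} (h : a < b) (hc : 0 < c) : c * a < c * b := by
  rw [mul_comm c a, mul_comm c b]; exact mul_lt_mul_right' h hc

theorem mul_le_mul_right' {a b : Tmax Γ} (h : a ≤ b) (c : Tmax Γ) : a * c ≤ b * c := by
  rcases h.eq_or_lt with rfl | h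
  · exact le_rfl
  · rcases (zero_le c).eq_or_lt with rfl | hc
    · simp
    · exact (mul_lt_mul_right' h hc).le

end Tmax

/-! ### Pairs of tropical numbers -/

/-- Pairs of tropical numbers, with the operations
`(a₁, a₂) + (b₁, b₂) = (a₁ + b₁, a₂ + b₂)` and
`(a₁, a₂) * (b₁, b₂) = (a₁ b₁ + a₂ b₂, a₁ b₂ + a₂ b₁)`. -/
@[ext]
structure TmaxPair (Γ : Type*) where
  fst : Tmax Γ
  snd : Tmax Γ

namespace TmaxPair

variable {Γ : Type*} [AddCommGroup Γ] [LinearOrder Γ] [IsOrderedAddMonoid Γ]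

instance : Zero (TmaxPair Γ) := ⟨⟨0, 0⟩⟩
instance : One (TmaxPair Γ) := ⟨⟨1, 0⟩⟩
instance : Add (TmaxPair Γ) := ⟨fun a b => ⟨a.fst + b.fst, a.snd + b.snd⟩⟩
instance : Mul (TmaxPair Γ) :=
  ⟨fun a b => ⟨a.fst * b.fst + a.snd * b.snd, a.fst * b.snd + a.snd * b.fst⟩⟩
/-- The minus operator `(a₁, a₂) ↦ (a₂, a₁)`. -/
instance : Neg (TmaxPair Γ) := ⟨fun a => ⟨a.snd, a.fst⟩⟩

@[simp] theorem zero_fst : (0 : TmaxPair Γ).fst = 0 := rfl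
@[simp] theorem zero_snd : (0 : TmaxPair Γ).snd = 0 := rfl
@[simp] theorem one_fst : (1 : TmaxPair Γ).fst = 1 := rfl
@[simp] theorem one_snd : (1 : TmaxPair Γ).snd = 0 := rfl
@[simp] theorem add_fst (a b : TmaxPair Γ) : (a + b).fst = a.fst + b.fst := rfl
@[simp] theorem add_snd (a b : TmaxPair Γ) : (a + b).snd = a.snd + b.snd := rfl
@[simp] theorem mul_fst (a b : TmaxPair Γ) :
    (a * b).fst = a.fst * b.fst + a.snd * b.snd := rfl
@[simp] theorem mul_snd (a b : TmaxPair Γ) :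
    (a * b).snd = a.fst * b.snd + a.snd * b.fst := rfl
@[simp] theorem neg_fst (a : TmaxPair Γ) : (-a).fst = a.snd := rfl
@[simp] theorem neg_snd (a : TmaxPair Γ) : (-a).snd = a.fst := rfl

instance : CommSemiring (TmaxPair Γ) where
  add_assoc a b c := by ext <;> simp [add_assoc]
  add_comm a b := by ext <;> simp [add_comm]
  zero_add a := by ext <;> simp
  add_zero a := by ext <;> simp
  mul_assoc a b c := by ext <;> simp <;> ring
  mul_comm a b := by ext <;> simp <;> ring
  one_mul a := by ext <;> simp
  mul_one a := by ext <;> simp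
  zero_mul a := by ext <;> simp
  mul_zero a := by ext <;> simp
  left_distrib a b c := by ext <;> simp <;> ring
  right_distrib a b c := by ext <;> simp <;> ring
  nsmul := nsmulRec
  npow := npowRec

/-- The relation by which pairs are identified: `a₁ + b₂ = a₂ + b₁` if `a₁ ≠ a₂` and `b₁ ≠ b₂`,
and `a = b` otherwise. -/
def Rel (a b : TmaxPair Γ) : Prop :=
  (a.fst ≠ a.snd ∧ b.fst ≠ b.snd ∧ a.fst + b.snd = a.snd + b.fst) ∨
    (¬ (a.fst ≠ a.snd ∧ b.fst ≠ b.snd) ∧ a = b)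

theorem rel_iff (a b : TmaxPair Γ) :
    Rel a b ↔ a = b ∨ (a.snd < a.fst ∧ b.snd < b.fst ∧ a.fst = b.fst) ∨
      (a.fst < a.snd ∧ b.fst < b.snd ∧ a.snd = b.snd) := by
  obtain ⟨a₁, a₂⟩ := a
  obtain ⟨b₁, b₂⟩ := b
  simp only [Rel, Tmax.add_def, TmaxPair.mk.injEq]
  constructor
  · rintro (⟨ha, hb, h⟩ | ⟨-, h⟩)
    · rcases lt_or_gt_of_ne ha with ha | ha <;> rcases lt_or_gt_of_ne hb with hb | hb <;> grind
    · exact Or.inl h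
  · rintro (⟨rfl, rfl⟩ | ⟨ha, hb, rfl⟩ | ⟨ha, hb, rfl⟩)
    · by_cases h : a₁ = a₂
      · exact Or.inr ⟨fun h' => h'.1 h, rfl, rfl⟩
      · exact Or.inl ⟨h, h, max_comm _ _⟩
    · exact Or.inl ⟨ha.ne', hb.ne', by rw [max_eq_left hb.le, max_eq_right ha.le]⟩
    · exact Or.inl ⟨ha.ne, hb.ne, by rw [max_eq_right ha.le, max_eq_left hb.le]⟩

theorem Rel.refl (a : TmaxPair Γ) : Rel a a := (rel_iff a a).2 (Or.inl rfl)

theorem Rel.symm {a b : TmaxPair Γ} (h : Rel a b) : Rel b a := by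
  rw [rel_iff] at h ⊢
  grind

theorem Rel.trans {a b c : TmaxPair Γ} (h : Rel a b) (h' : Rel b c) : Rel a c := by
  rw [rel_iff] at h h' ⊢
  grind

theorem Rel.neg {a b : TmaxPair Γ} (h : Rel a b) : Rel (-a) (-b) := by
  rw [rel_iff] at h ⊢
  rcases h with rfl | h | h
  · exact Or.inl rfl
  · exact Or.inr (Or.inr h)
  · exact Or.inr (Or.inl h)

theorem neg_neg' (a : TmaxPair Γ) : - -a = a := rfl

theorem neg_add' (a b : TmaxPair Γ) : -(a + b) = -a + -b := rfl

theorem neg_mul' (a b : TmaxPair Γ) : -a * b = -(a * b) := by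
  ext <;> simp [add_comm]

theorem Rel.add_right {a b : TmaxPair Γ} (h : Rel a b) (c : TmaxPair Γ) :
    Rel (a + c) (b + c) := by
  rw [rel_iff] at h ⊢
  obtain ⟨a₁, a₂⟩ := a
  obtain ⟨b₁, b₂⟩ := b
  obtain ⟨c₁, c₂⟩ := c
  simp only [add_fst, add_snd, Tmax.add_def, TmaxPair.ext_iff] at h ⊢
  grind

theorem Rel.mul_right_aux {a b : TmaxPair Γ} (ha : a.snd < a.fst) (hb : b.snd < b.fst)
    (hab : a.fst = b.fst) (c : TmaxPair Γ) : Rel (a * c) (b * c) := by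
  have key : ∀ x : TmaxPair Γ, x.snd < x.fst →
      (c.snd < c.fst → (x * c).snd < (x * c).fst ∧ (x * c).fst = x.fst * c.fst) ∧
      (c.fst < c.snd → (x * c).fst < (x * c).snd ∧ (x * c).snd = x.fst * c.snd) ∧
      (c.fst = c.snd → x * c = ⟨x.fst * c.fst, x.fst * c.fst⟩) := by
    intro x hx
    have hx0 : 0 < x.fst := lt_of_le_of_lt (Tmax.zero_le _) hx
    refine ⟨fun hc => ?_, fun hc => ?_, fun hc => ?_⟩
    · have hc0 : 0 < c.fst := lt_of_le_of_lt (Tmax.zero_le _) hc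
      have h1 : x.fst * c.snd < x.fst * c.fst := Tmax.mul_lt_mul_left' hc hx0
      have h2 : x.snd * c.fst < x.fst * c.fst := Tmax.mul_lt_mul_right' hx hc0
      have h3 : x.snd * c.snd ≤ x.fst * c.snd := Tmax.mul_le_mul_right' hx.le _
      simp only [mul_fst, mul_snd, Tmax.add_def]
      rw [max_eq_left (h3.trans h1.le)]
      exact ⟨max_lt h1 h2, rfl⟩
    · have hc0 : 0 < c.snd := lt_of_le_of_lt (Tmax.zero_le _) hc
      have h1 : x.fst * c.fst < x.fst * c.snd := Tmax.mul_lt_mul_left' hc hx0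
      have h2 : x.snd * c.snd < x.fst * c.snd := Tmax.mul_lt_mul_right' hx hc0
      have h3 : x.snd * c.fst ≤ x.fst * c.fst := Tmax.mul_le_mul_right' hx.le _
      simp only [mul_fst, mul_snd, Tmax.add_def]
      rw [max_eq_left (h3.trans h1.le)]
      exact ⟨max_lt h1 h2, rfl⟩
    · have h3 : x.snd * c.snd ≤ x.fst * c.snd := Tmax.mul_le_mul_right' hx.le _
      ext
      · simp only [mul_fst, Tmax.add_def, hc]
        exact max_eq_left h3
      · simp only [mul_snd, Tmax.add_def, hc]
        exact max_eq_left h3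
  rw [rel_iff]
  obtain ⟨a1, a2, a3⟩ := key a ha
  obtain ⟨b1, b2, b3⟩ := key b hb
  rcases lt_trichotomy c.fst c.snd with hc | hc | hc
  · exact Or.inr (Or.inr ⟨(a2 hc).1, (b2 hc).1, by rw [(a2 hc).2, (b2 hc).2, hab]⟩)
  · exact Or.inl (by rw [a3 hc, b3 hc, hab])
  · exact Or.inr (Or.inl ⟨(a1 hc).1, (b1 hc).1, by rw [(a1 hc).2, (b1 hc).2, hab]⟩)

theorem Rel.mul_right {a b : TmaxPair Γ} (h : Rel a b) (c : TmaxPair Γ) :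
    Rel (a * c) (b * c) := by
  rcases (rel_iff a b).1 h with rfl | ⟨ha, hb, hab⟩ | ⟨ha, hb, hab⟩
  · exact Rel.refl _
  · exact Rel.mul_right_aux ha hb hab c
  · have := (Rel.mul_right_aux (a := -a) (b := -b) ha hb hab c).neg
    rwa [neg_mul', neg_mul', neg_neg', neg_neg'] at this

/-- `Rel` as a congruence of the semiring of pairs. -/
def con (Γ : Type*) [AddCommGroup Γ] [LinearOrder Γ] [IsOrderedAddMonoid Γ] :
    RingCon (TmaxPair Γ) where
  r := Rel
  iseqv := ⟨Rel.refl, Rel.symm, Rel.trans⟩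
  add' {a b c d} h h' := by
    refine (h.add_right c).trans ?_
    rw [add_comm b c, add_comm b d]
    exact h'.add_right b
  mul' {a b c d} h h' := by
    refine (h.mul_right c).trans ?_
    rw [mul_comm b c, mul_comm b d]
    exact h'.mul_right b

/-- The absolute value `|(a₁, a₂)| = a₁ + a₂` of pairs, as a morphism of semirings. -/
def abs (Γ : Type*) [AddCommGroup Γ] [LinearOrder Γ] [IsOrderedAddMonoid Γ] :
    TmaxPair Γ →+* Tmax Γ where
  toFun a := a.fst + a.snd
  map_zero' := by simp
  map_one' := by simp
  map_add' a b := by simp only [add_fst, add_snd]; ring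
  map_mul' a b := by simp only [mul_fst, mul_snd]; ring

theorem abs_eq_of_rel {a b : TmaxPair Γ} (h : Rel a b) : abs Γ a = abs Γ b := by
  change a.fst + a.snd = b.fst + b.snd
  rcases (rel_iff a b).1 h with rfl | ⟨ha, hb, hab⟩ | ⟨ha, hb, hab⟩
  · rfl
  · rw [Tmax.add_def, Tmax.add_def, max_eq_left ha.le, max_eq_left hb.le, hab]
  · rw [Tmax.add_def, Tmax.add_def, max_eq_right ha.le, max_eq_right hb.le, hab]

end TmaxPair

/-! ### The symmetrized tropical semiring -/

/-- The symmetrized tropical semiring: the quotient of the semiring of pairs of tropical numbers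
by the congruence `TmaxPair.Rel`. -/
def Smax (Γ : Type*) [AddCommGroup Γ] [LinearOrder Γ] [IsOrderedAddMonoid Γ] : Type _ :=
  (TmaxPair.con Γ).Quotient

namespace Smax

variable {Γ : Type*} [AddCommGroup Γ] [LinearOrder Γ] [IsOrderedAddMonoid Γ]

instance : CommSemiring (Smax Γ) := inferInstanceAs (CommSemiring (TmaxPair.con Γ).Quotient)

/-- The class of a pair, as a morphism of semirings. -/
def mk : TmaxPair Γ →+* Smax Γ := (TmaxPair.con Γ).mk'

theorem mk_surjective : Function.Surjective (mk : TmaxPair Γ → Smax Γ) :=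
  (TmaxPair.con Γ).mk'_surjective

theorem mk_eq_mk {a b : TmaxPair Γ} : mk a = mk b ↔ TmaxPair.Rel a b :=
  (TmaxPair.con Γ).eq

/-- The minus operator `⊖`, induced by `(a₁, a₂) ↦ (a₂, a₁)`. The element `a ⊖ b` is written
`a + -b` below. -/
instance : Neg (Smax Γ) :=
  ⟨Quotient.map (sa := (TmaxPair.con Γ).toSetoid) (sb := (TmaxPair.con Γ).toSetoid)
    (fun a => -a) (fun _ _ h => TmaxPair.Rel.neg h)⟩

theorem neg_mk (a : TmaxPair Γ) : -(mk a) = mk (-a) := rfl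

/-- The absolute value, induced by `(a₁, a₂) ↦ a₁ + a₂`, as a morphism of semirings. -/
def abs (Γ : Type*) [AddCommGroup Γ] [LinearOrder Γ] [IsOrderedAddMonoid Γ] :
    Smax Γ →+* Tmax Γ :=
  (TmaxPair.con Γ).lift (TmaxPair.abs Γ) (fun _ _ h => TmaxPair.abs_eq_of_rel h)

theorem abs_mk (a : TmaxPair Γ) : abs Γ (mk a) = a.fst + a.snd := rfl

/-- The embedding `c ↦ (c, ⊥)` of the tropical semifield as the set of positive or zero
elements. -/
def pos (c : Tmax Γ) : Smax Γ := mk ⟨c, 0⟩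

/-- Signed elements: positive, negative or zero. -/
def IsSigned (x : Smax Γ) : Prop := ∃ c : Tmax Γ, x = pos c ∨ x = -pos c

/-- Tangible elements: the nonzero signed elements. -/
def IsTangible (x : Smax Γ) : Prop := IsSigned x ∧ x ≠ 0

/-- Balance elements: the classes of the pairs `(c, c)`. -/
def IsBalanced (x : Smax Γ) : Prop := ∃ c : Tmax Γ, x = mk ⟨c, c⟩

/-- The surpassing relation `a ≼° b`: `b = a + c` for some balance element `c`. -/
def Surpass (a b : Smax Γ) : Prop := ∃ c : Smax Γ, IsBalanced c ∧ b = a + c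

/-- The balance relation `a ∇ b`, that is `0 ≼° a ⊖ b`. -/
def Balances (a b : Smax Γ) : Prop := Surpass 0 (a + -b)

/-- On pairs, `a ∇ b` means `a₁ + b₂ = a₂ + b₁`. -/
theorem balances_mk (a b : TmaxPair Γ) :
    Balances (mk a) (mk b) ↔ a.fst + b.snd = a.snd + b.fst := by
  have h : Balances (mk a) (mk b) ↔ ∃ c : Tmax Γ, mk (a + -b) = mk ⟨c, c⟩ := by
    simp [Balances, Surpass, IsBalanced, neg_mk, map_add]
  rw [h]
  constructor
  · rintro ⟨c, hc⟩
    rw [mk_eq_mk, TmaxPair.rel_iff] at hc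
    rcases hc with hc | hc | hc
    · have h1 := congrArg TmaxPair.fst hc
      have h2 := congrArg TmaxPair.snd hc
      simp only [TmaxPair.add_fst, TmaxPair.add_snd, TmaxPair.neg_fst, TmaxPair.neg_snd] at h1 h2
      rw [h1, h2]
    · exact absurd hc.2.1 (lt_irrefl c)
    · exact absurd hc.2.1 (lt_irrefl c)
  · intro h
    refine ⟨a.fst + b.snd, congrArg mk ?_⟩
    ext
    · rfl
    · exact h.symm

end Smax

/-! ### Formal polynomials over the tropical semifield -/

namespace Tmax

variable {Γ : Type*} [AddCommGroup Γ] [LinearOrder Γ] [IsOrderedAddMonoid Γ]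

/-- A formal polynomial of degree `n` over the tropical semifield is factored if
`P = P_n (Y ⊕ c₁) ⋯ (Y ⊕ c_n)`, as formal polynomials, for some tropical numbers `c_i`. -/
def IsFactored (P : (Tmax Γ)[X]) : Prop :=
  ∃ c : Multiset (Tmax Γ), Multiset.card c = P.natDegree ∧
    P = C P.leadingCoeff * (c.map fun a => X + C a).prod

/-- `c` is a corner of `P`: if `c ≠ 0`, the maximum of the monomials of `P` at `c` is attained by
at least two different monomials; if `c = 0`, there is no constant term. -/
def IsCorner (P : (Tmax Γ)[X]) (c : Tmax Γ) : Prop :=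
  (c ≠ 0 ∧ ∃ i ∈ P.support, ∃ j ∈ P.support, i ≠ j ∧
    P.coeff i * c ^ i = P.eval c ∧ P.coeff j * c ^ j = P.eval c) ∨
  (c = 0 ∧ P.coeff 0 = 0)

end Tmax

/-! ### Formal polynomials over the symmetrized tropical semiring -/

namespace Smax

variable {Γ : Type*} [AddCommGroup Γ] [LinearOrder Γ] [IsOrderedAddMonoid Γ]

/-- Formal polynomials with signed coefficients. -/
def IsSignedPoly (P : (Smax Γ)[X]) : Prop := ∀ k, IsSigned (P.coeff k)

/-- The formal polynomial `|P|`, by the absolute value of each coefficient. -/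
noncomputable def absPoly (P : (Smax Γ)[X]) : (Tmax Γ)[X] := P.map (abs Γ)

/-- (Signed) roots: signed elements `y` at which the value of `P` balances `0`. -/
def IsRoot (P : (Smax Γ)[X]) (y : Smax Γ) : Prop := IsSigned y ∧ Balances (P.eval y) 0

/-- Coefficientwise balance relation. -/
def BalancesPoly (P Q : (Smax Γ)[X]) : Prop := ∀ k, Balances (P.coeff k) (Q.coeff k)

/-- `Q` is a quotient of `P` by `Y ⊖ a`: it has signed coefficients, and
`λ P ∇ (Y ⊖ a) Q` for some tangible `λ`. -/
def IsQuotientBy (a : Smax Γ) (P Q : (Smax Γ)[X]) : Prop :=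
  IsSignedPoly Q ∧ ∃ l : Smax Γ, IsTangible l ∧ BalancesPoly (C l * P) ((X + C (-a)) * Q)

/-- `MultGE a P k` says that the recursion defining the multiplicity of `a` as a root of `P` can be
unfolded so as to give at least the value `k`. -/
inductive MultGE (a : Smax Γ) : (Smax Γ)[X] → ℕ → Prop
  | zero (P : (Smax Γ)[X]) : MultGE a P 0
  | one (P : (Smax Γ)[X]) : IsRoot P a → MultGE a P 1
  | succ (P Q : (Smax Γ)[X]) (k : ℕ) :
      IsRoot P a → IsQuotientBy a P Q → MultGE a Q k → MultGE a P (k + 1)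

/-- The multiplicity of `a` as a root of a formal polynomial `P` with signed coefficients. See
`mult_of_not_isRoot` and `mult_of_isRoot` for the recursion that characterizes it: it is `0` if `a`
is not a root, and otherwise it is one plus the supremum of the multiplicities of `a` as a root of
the quotients of `P` by `Y ⊖ a`. -/
noncomputable def mult (a : Smax Γ) (P : (Smax Γ)[X]) : ℕ∞ :=
  ⨆ (k : ℕ) (_ : MultGE a P k), (k : ℕ∞)

theorem MultGE.le_mult {a : Smax Γ} {P : (Smax Γ)[X]} {k : ℕ} (h : MultGE a P k) :
    (k : ℕ∞) ≤ mult a P :=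
  le_iSup₂ (f := fun (k : ℕ) (_ : MultGE a P k) => (k : ℕ∞)) k h

theorem mult_of_not_isRoot {a : Smax Γ} {P : (Smax Γ)[X]} (h : ¬ IsRoot P a) :
    mult a P = 0 := by
  rw [← nonpos_iff_eq_zero]
  refine iSup₂_le fun k hk => ?_
  cases hk with
  | zero => simp
  | one _ h' => exact absurd h' h
  | succ _ _ _ h' _ _ => exact absurd h' h

theorem mult_of_isRoot {a : Smax Γ} {P : (Smax Γ)[X]} (h : IsRoot P a) :
    mult a P = 1 + ⨆ (Q : (Smax Γ)[X]) (_ : IsQuotientBy a P Q), mult a Q := by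
  apply le_antisymm
  · refine iSup₂_le fun k hk => ?_
    cases hk with
    | zero => simp
    | one _ h' => simp
    | succ _ Q k _ hQ hk =>
      rw [Nat.cast_add, Nat.cast_one, add_comm]
      gcongr
      exact hk.le_mult.trans
        (le_iSup₂ (f := fun (Q : (Smax Γ)[X]) (_ : IsQuotientBy a P Q) => mult a Q) Q hQ)
  · have h1 : (1 : ℕ∞) ≤ mult a P := by
      simpa using (MultGE.one P h : MultGE a P 1).le_mult
    have h2 : (⨆ (Q : (Smax Γ)[X]) (_ : IsQuotientBy a P Q), mult a Q) ≤ mult a P - 1 := by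
      refine iSup₂_le fun Q hQ => iSup₂_le fun k hk => ?_
      have := (MultGE.succ P Q k h hQ hk).le_mult
      refine ENat.le_sub_of_add_le_right (by simp) ?_
      simpa using this
    calc _ ≤ 1 + (mult a P - 1) := by gcongr
      _ = mult a P := add_tsub_cancel_of_le h1

/-- The multiset `s` of signed elements `r₁, …, r_n`, where `n` is the degree of `P`, is a
factorization of the polynomial function of `P`, that is
`P̂(y) = P_n (y ⊖ r₁) ⋯ (y ⊖ r_n)` for all `y`. -/
def IsFactorization (P : (Smax Γ)[X]) (s : Multiset (Smax Γ)) : Prop :=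
  (∀ r ∈ s, IsSigned r) ∧ Multiset.card s = P.natDegree ∧
    ∀ y : Smax Γ, P.eval y = P.leadingCoeff * (s.map fun r => y + -r).prod

/-- The sequence `r₁, …, r_n` (here `r i` is `r_{i+1}`) of signed elements determined by
`r_i P_{n-i+1} = ⊖ P_{n-i}` for `i ≤ n - m` and `r_i = 0` for `n - m < i ≤ n`, where `n` is the
degree and `m` the lower degree of `P`. -/
def IsRootSequence (P : (Smax Γ)[X]) (r : Fin P.natDegree → Smax Γ) : Prop :=
  ∀ i : Fin P.natDegree, IsSigned (r i) ∧
    ((i : ℕ) + 1 ≤ P.natDegree - P.natTrailingDegree →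
      r i * P.coeff (P.natDegree - i) = -P.coeff (P.natDegree - (i + 1))) ∧
    (P.natDegree - P.natTrailingDegree < (i : ℕ) + 1 → r i = 0)

end Smax

/-!
The recursion `P_{n-i} = ⊖ r_i P_{n-i+1}` describes the formal polynomial `P_n (Y ⊖ r₁) ⋯ (Y ⊖ r_n)`
as soon as each `⊖ r_i` absorbs the later ones. Since `|P|` is factored the moduli `|r_i|` decrease,
and for signed elements of decreasing moduli absorption fails only between distinct elements of the
same modulus; this is condition (a). Signed elements have no zero divisors and `y ⊖ s` is balanced,
for signed `y` and `s`, only if `y = s`, so under (a) the roots are exactly the `r_i`. Comparing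
moduli of values over `𝕋max` then gives uniqueness.

For multiplicities, the largest monomials of `|P|` at `|x| ≠ 0` occupy the interval of degrees cut
out by the `r_i` of modulus `|x|`. Passing from `P` to a quotient by `Y ⊖ x` makes the range of
these degrees shrink by at least one, which bounds the multiplicity from above. For `x = 0` the
order of vanishing at `0` plays the same role.
-/

section Absorbing

variable {R : Type*} [CommSemiring R] {n : ℕ}

/-- A finite sequence in which every term absorbs the later ones under addition. In `Tmax Γ` these
are the antitone sequences; in `Smax Γ` they make the product of the `X + C (u i)` as explicit as
it is there. -/
def IsAbsorbing (u : Fin n → R) : Prop := ∀ ⦃i j⦄, i < j → u i + u j = u i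

theorem prod_filter_lt_succ (u : Fin n → R) (k : Fin n) :
    ∏ i : Fin n with i.val < k.val + 1, u i =
      u k * ∏ i : Fin n with i.val < k.val, u i := by
  have hinsert : (Finset.univ.filter fun i : Fin n => i.val < k.val + 1) =
      insert k (Finset.univ.filter fun i : Fin n => i.val < k.val) := by
    ext i
    simp only [Finset.mem_filter_univ, Finset.mem_insert, Fin.ext_iff]
    omega
  rw [hinsert, Finset.prod_insert (by simp)]

theorem natDegree_prod_X_add_C_le (u : Fin n → R) : (∏ i, (X + C (u i))).natDegree ≤ n := by
  refine (natDegree_prod_le _ _).trans ?_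
  simpa using Nat.mul_le_mul_left n (natDegree_X_le (R := R))

theorem IsAbsorbing.coeff_prod_X_add_C {u : Fin n → R} (hu : IsAbsorbing u) {t : ℕ} (ht : t ≤ n) :
    (∏ i, (X + C (u i))).coeff (n - t) = ∏ i : Fin n with i.val < t, u i := by
  induction n generalizing t with
  | zero => simp
  | succ n ih =>
    have ih := @ih _ fun i j hij => hu (Fin.succ_lt_succ_iff.2 hij)
    rw [Fin.prod_univ_succ, add_mul, coeff_add, coeff_C_mul]
    obtain _ | t := t
    · rw [Nat.sub_zero, coeff_X_mul, coeff_eq_zero_of_natDegree_lt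
        (Nat.lt_succ_of_le (natDegree_prod_X_add_C_le _)), mul_zero, add_zero]
      simpa using ih (Nat.zero_le n)
    · have hsplit : ∏ i : Fin (n + 1) with i.val < t + 1, u i =
          u 0 * ∏ i : Fin n with i.val < t, u i.succ := by
        simp [Finset.prod_filter, Fin.prod_univ_succ]
      rw [hsplit, Nat.add_sub_add_right, ih (by omega)]
      obtain htn | rfl := (Nat.le_of_succ_le_succ ht).lt_or_eq
      · have hlast := prod_filter_lt_succ (fun i => u (Fin.succ i)) ⟨t, htn⟩
        rw [show n - t = n - (t + 1) + 1 by omega, coeff_X_mul, ih htn, hlast, ← add_mul,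
          add_comm (u _), hu (Fin.succ_pos _)]
      · rw [Nat.sub_self, coeff_X_mul_zero, zero_add]

theorem IsAbsorbing.coeff_C_mul_prod_X_add_C_succ {u : Fin n → R} (hu : IsAbsorbing u) (a : R)
    (i : Fin n) : (C a * ∏ i, (X + C (u i))).coeff (n - (i + 1)) =
      u i * (C a * ∏ i, (X + C (u i))).coeff (n - i) := by
  rw [coeff_C_mul, coeff_C_mul, hu.coeff_prod_X_add_C i.isLt, hu.coeff_prod_X_add_C i.isLt.le,
    prod_filter_lt_succ, mul_left_comm]

theorem IsAbsorbing.eq_C_mul_prod_X_add_C {u : Fin n → R} (hu : IsAbsorbing u) {P : R[X]}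
    (hdeg : P.natDegree ≤ n) (hP : ∀ i : Fin n, P.coeff (n - (i + 1)) = u i * P.coeff (n - i)) :
    P = C (P.coeff n) * ∏ i, (X + C (u i)) := by
  have hcoeff : ∀ t ≤ n, P.coeff (n - t) = P.coeff n * ∏ i : Fin n with i.val < t, u i := by
    intro t ht
    induction t with
    | zero => simp
    | succ t ih =>
      rw [hP ⟨t, ht⟩, ih (by omega), prod_filter_lt_succ u ⟨t, ht⟩, mul_left_comm]
  ext k
  rw [coeff_C_mul]
  obtain hk | hk := le_or_gt k n
  · rw [← Nat.sub_sub_self hk, hcoeff _ (by omega), hu.coeff_prod_X_add_C (by omega)]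
  · rw [coeff_eq_zero_of_natDegree_lt (hdeg.trans_lt hk),
      coeff_eq_zero_of_natDegree_lt ((natDegree_prod_X_add_C_le u).trans_lt hk), mul_zero]

end Absorbing

section Preliminaries

theorem exists_antitone_comp_map_univ_eq {α β : Type*} [LinearOrder β] (f : α → β)
    {s : Multiset α} {n : ℕ} (hs : Multiset.card s = n) :
    ∃ r : Fin n → α, Finset.univ.val.map r = s ∧ Antitone (f ∘ r) := by
  obtain ⟨l, rfl⟩ : ∃ l : List α, (l : Multiset α) = s := ⟨s.toList, s.coe_toList⟩
  obtain rfl : l.length = n := hs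
  let σ := Tuple.sort (OrderDual.toDual ∘ f ∘ l.get)
  refine ⟨l.get ∘ σ, ?_, fun i j hij => Tuple.monotone_sort (OrderDual.toDual ∘ f ∘ l.get) hij⟩
  rw [← Multiset.map_map, Multiset.map_univ_val_equiv σ, Fin.univ_val_map, List.ofFn_get]

theorem eq_of_map_eq_map_of_injOn {α β : Type*} {f : α → β} {s t : Multiset α}
    (hinj : Set.InjOn f {x | x ∈ t}) (hsub : ∀ x ∈ s, x ∈ t) (h : s.map f = t.map f) : s = t := by
  obtain rfl | ⟨x₀, -⟩ := t.empty_or_exists_mem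
  · simpa using h
  have : Nonempty α := ⟨x₀⟩
  have hinv : ∀ x ∈ t, Function.invFunOn f {x | x ∈ t} (f x) = x := hinj.leftInvOn_invFunOn
  have hmap := congrArg (Multiset.map (Function.invFunOn f {x | x ∈ t})) h
  rw [Multiset.map_map, Multiset.map_map] at hmap
  calc s = s.map (Function.invFunOn f {x | x ∈ t} ∘ f) :=
        ((Multiset.map_congr rfl fun x hx => hinv x (hsub x hx)).trans s.map_id').symm
    _ = t.map (Function.invFunOn f {x | x ∈ t} ∘ f) := hmap
    _ = t := (Multiset.map_congr rfl hinv).trans t.map_id'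

theorem injOn_setOf_mem_map_univ {α β ι : Type*} [Fintype ι] {f : α → β} {r : ι → α}
    (h : ∀ i j, f (r i) = f (r j) → r i = r j) : Set.InjOn f {x | x ∈ Finset.univ.val.map r} := by
  intro x hx y hy
  obtain ⟨i, -, rfl⟩ := Multiset.mem_map.1 hx
  obtain ⟨j, -, rfl⟩ := Multiset.mem_map.1 hy
  exact h i j

theorem count_map_univ {α ι : Type*} [Fintype ι] [DecidableEq α] (r : ι → α) (x : α) :
    (Finset.univ.val.map r).count x = Nat.card {i // r i = x} := by
  rw [Multiset.count_map, Nat.card_eq_fintype_card, Fintype.card_subtype]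
  simp only [eq_comm (a := x)]
  rfl

theorem sub_le_natCard_subtype {n a b : ℕ} {p : Fin n → Prop} (hb : b ≤ n)
    (hp : ∀ i : Fin n, a ≤ i.val → i.val < b → p i) : b - a ≤ Nat.card {i // p i} := by
  have hinj : Function.Injective fun t : Fin (b - a) =>
      (⟨⟨a + t, by omega⟩, hp _ (by simp) (by simp; omega)⟩ : {i // p i}) := fun t u htu => by
    simpa [Fin.ext_iff] using htu
  simpa using Nat.card_le_card_of_injective _ hinj

theorem sum_eq_sup {R ι : Type*} [IdemSemiring R] (s : Finset ι) (f : ι → R) :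
    ∑ i ∈ s, f i = s.sup f := by
  classical
  induction s using Finset.induction_on with
  | empty => exact bot_eq_zero.symm
  | insert i s hi ih => rw [Finset.sum_insert hi, Finset.sup_insert, ih, add_eq_sup]

theorem coeff_mul_pow_le_eval {R : Type*} [IdemSemiring R] (p : R[X]) (c : R) (k : ℕ) :
    p.coeff k * c ^ k ≤ p.eval c := by
  by_cases hk : k ∈ p.support
  · rw [eval_eq_sum, sum_def, sum_eq_sup]
    exact Finset.le_sup (f := fun k => p.coeff k * c ^ k) hk
  · rw [notMem_support_iff.1 hk, zero_mul]
    exact zero_le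

theorem prod_eq_prod_iff_of_le₀ {M ι : Type*} [LinearOrderedCommGroupWithZero M] {s : Finset ι}
    {f g : ι → M} (hle : ∀ i ∈ s, f i ≤ g i) (hg : ∀ i ∈ s, g i ≠ 0) :
    ∏ i ∈ s, f i = ∏ i ∈ s, g i ↔ ∀ i ∈ s, f i = g i := by
  refine ⟨fun heq i hi => ?_, Finset.prod_congr rfl⟩
  by_contra hne
  have hf : ∀ j ∈ s, 0 < f j := fun j hj => zero_lt_iff.2 fun hj0 =>
    Finset.prod_ne_zero_iff.2 hg (heq ▸ Finset.prod_eq_zero hj hj0)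
  exact (Finset.prod_lt_prod hf hle ⟨i, hi, (hle i hi).lt_of_ne hne⟩).ne heq

end Preliminaries

namespace Tmax

variable {Γ : Type*} [AddCommGroup Γ] [LinearOrder Γ] [IsOrderedAddMonoid Γ]

scoped instance : IdemCommSemiring (Tmax Γ) where
  sup := max
  le_sup_left := le_max_left
  le_sup_right := le_max_right
  sup_le _ _ _ := max_le
  bot := 0
  bot_le := zero_le

scoped instance : LinearOrderedCommGroupWithZero (Tmax Γ) where
  inv a := (WithBot.map Neg.neg a : WithBot Γ)
  inv_zero := rfl
  mul_inv_cancel a ha := by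
    induction a using WithBot.recBotCoe with
    | bot => exact absurd rfl ha
    | coe g => exact congrArg WithBot.some (add_neg_cancel g)
  exists_pair_ne := ⟨0, 1, WithBot.bot_ne_coe⟩
  bot := 0
  bot_le := zero_le
  isBot_zero := zero_le
  mul_lt_mul_of_pos_left _ ha _ _ h := mul_lt_mul_left' h ha

theorem exists_ne_zero_lt [Nontrivial Γ] {a : Tmax Γ} (ha : a ≠ 0) :
    ∃ b : Tmax Γ, b ≠ 0 ∧ b < a := by
  induction a using WithBot.recBotCoe with
  | bot => exact absurd rfl ha
  | coe g =>
    obtain ⟨d, hd⟩ := exists_lt g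
    exact ⟨(d : WithBot Γ), WithBot.coe_ne_bot, WithBot.coe_lt_coe.2 hd⟩

theorem isAbsorbing_iff_antitone {n : ℕ} {u : Fin n → Tmax Γ} : IsAbsorbing u ↔ Antitone u := by
  simp only [IsAbsorbing, add_eq_left_iff_le, antitone_iff_forall_lt]

/-- The monomial of degree `k` attains the maximum `p.eval c` of the monomials of `p` at `c`. -/
def IsDominant (p : (Tmax Γ)[X]) (c : Tmax Γ) (k : ℕ) : Prop := p.coeff k * c ^ k = p.eval c

theorem exists_isDominant (p : (Tmax Γ)[X]) (c : Tmax Γ) : ∃ k, IsDominant p c k := by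
  obtain ⟨k, -, hk⟩ := Finset.exists_mem_eq_sup (Finset.range (p.natDegree + 1)) ⟨0, by simp⟩
    fun k => p.coeff k * c ^ k
  exact ⟨k, by rw [IsDominant, eval_eq_sum_range, sum_eq_sup, hk]⟩

theorem eval_ne_zero {p : (Tmax Γ)[X]} {c : Tmax Γ} (hp : p ≠ 0) (hc : c ≠ 0) : p.eval c ≠ 0 := by
  have hlead := mul_ne_zero (leadingCoeff_ne_zero.2 hp) (pow_ne_zero p.natDegree hc)
  exact fun h => hlead (nonpos_iff_eq_zero.1 (h ▸ coeff_mul_pow_le_eval p c p.natDegree))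

theorem IsDominant.coeff_ne_zero {p : (Tmax Γ)[X]} {c : Tmax Γ} {k : ℕ} (h : IsDominant p c k)
    (hp : p ≠ 0) (hc : c ≠ 0) : p.coeff k ≠ 0 :=
  left_ne_zero_of_mul (h.symm ▸ eval_ne_zero hp hc)

theorem isDominant_C_mul_iff {a c : Tmax Γ} {p : (Tmax Γ)[X]} {k : ℕ} (ha : a ≠ 0) :
    IsDominant (C a * p) c k ↔ IsDominant p c k := by
  rw [IsDominant, coeff_C_mul, eval_mul, eval_C, mul_assoc, mul_right_inj' ha, IsDominant]

theorem isDominant_X_add_C_mul_iff {c : Tmax Γ} {q : (Tmax Γ)[X]} {k : ℕ} (hc : c ≠ 0) :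
    IsDominant ((X + C c) * q) c k ↔ IsDominant q c k ∨ ∃ j, k = j + 1 ∧ IsDominant q c j := by
  have heval : ((X + C c) * q).eval c = c * q.eval c := by simp [add_idem]
  obtain _ | k := k
  · simp [IsDominant, heval, hc]
  · have hcoeff : ((X + C c) * q).coeff (k + 1) * c ^ (k + 1) =
        c * (q.coeff k * c ^ k + q.coeff (k + 1) * c ^ (k + 1)) := by
      rw [add_mul, coeff_add, coeff_X_mul, coeff_C_mul]
      ring
    have hle := coeff_mul_pow_le_eval q c k
    have hle' := coeff_mul_pow_le_eval q c (k + 1)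
    simp only [IsDominant, hcoeff, heval, mul_right_inj' hc, add_def, Nat.add_right_cancel_iff,
      exists_eq_left']
    grind

theorem isDominant_succ_iff_of_coeff_eq {p : (Tmax Γ)[X]} {c : Tmax Γ} {k : ℕ}
    (h : p.coeff k = c * p.coeff (k + 1)) : IsDominant p c (k + 1) ↔ IsDominant p c k := by
  rw [IsDominant, IsDominant, h, pow_succ', mul_left_comm, ← mul_assoc]

theorem IsDominant.of_coeff_le {p q : (Tmax Γ)[X]} {c : Tmax Γ} {k : ℕ} (h : IsDominant q c k)
    (hle : ∀ j, p.coeff j ≤ q.coeff j) (hk : p.coeff k = q.coeff k) : IsDominant p c k := by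
  obtain ⟨m, hm⟩ := exists_isDominant p c
  refine (coeff_mul_pow_le_eval p c k).antisymm ?_
  calc p.eval c = p.coeff m * c ^ m := hm.symm
    _ ≤ q.coeff m * c ^ m := mul_le_mul' (hle m) le_rfl
    _ ≤ q.eval c := coeff_mul_pow_le_eval q c m
    _ = p.coeff k * c ^ k := by rw [hk, h]

theorem isDominant_prod_iff {n t : ℕ} {u : Fin n → Tmax Γ} {a y : Tmax Γ} (hu : Antitone u)
    (ha : a ≠ 0) (hy : y ≠ 0) (ht : t ≤ n) :
    IsDominant (C a * ∏ i, (X + C (u i))) y (n - t) ↔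
      ∀ i : Fin n, if i.val < t then y ≤ u i else u i ≤ y := by
  have hmonomial : (∏ i, (X + C (u i))).coeff (n - t) * y ^ (n - t) =
      ∏ i : Fin n, if i.val < t then u i else y := by
    have hcard : (Finset.univ.filter fun i : Fin n => ¬ i.val < t).card = n - t := by
      have := Finset.card_filter_add_card_filter_not (s := Finset.univ) fun i : Fin n => i.val < t
      rw [Fin.card_filter_val_lt, Finset.card_fin] at this
      omega
    rw [(isAbsorbing_iff_antitone.2 hu).coeff_prod_X_add_C ht, Finset.prod_ite, Finset.prod_const,
      hcard]
  have hfactor : ∀ i : Fin n, (if i.val < t then u i else y) = y + u i ↔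
      if i.val < t then y ≤ u i else u i ≤ y := by
    intro i
    split_ifs
    exacts [eq_comm.trans add_eq_right_iff_le, eq_comm.trans add_eq_left_iff_le]
  rw [isDominant_C_mul_iff ha, IsDominant, hmonomial, eval_prod]
  simp only [eval_add, eval_X, eval_C]
  rw [prod_eq_prod_iff_of_le₀]
  · simp only [Finset.mem_univ, true_imp_iff, hfactor]
  · intro i _
    split_ifs
    exacts [le_add_self, le_self_add]
  · exact fun i _ h => hy (nonpos_iff_eq_zero.1 (h ▸ le_self_add))

theorem IsFactored.exists_antitone {p : (Tmax Γ)[X]} (h : IsFactored p) :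
    ∃ c : Fin p.natDegree → Tmax Γ, Antitone c ∧ ∀ i : Fin p.natDegree,
      p.coeff (p.natDegree - (i + 1)) = c i * p.coeff (p.natDegree - i) := by
  obtain ⟨s, hcard, hs⟩ := h
  obtain ⟨c, rfl, hc : Antitone c⟩ := exists_antitone_comp_map_univ_eq id hcard
  refine ⟨c, hc, fun i => ?_⟩
  have hp : p = C p.leadingCoeff * ∏ i, (X + C (c i)) := by rwa [Multiset.map_map] at hs
  have hcoeff := (isAbsorbing_iff_antitone.2 hc).coeff_C_mul_prod_X_add_C_succ p.leadingCoeff i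
  rwa [← hp] at hcoeff

theorem pow_card_le_prod_map_add (s : Multiset (Tmax Γ)) (y : Tmax Γ) :
    y ^ Multiset.card s ≤ (s.map fun u => y + u).prod := by
  simpa using Multiset.pow_card_le_prod (s := s.map fun u => y + u) (a := y) (by simp)

theorem prod_map_add_of_le {s : Multiset (Tmax Γ)} {y : Tmax Γ} (h : ∀ u ∈ s, u ≤ y) :
    (s.map fun u => y + u).prod = y ^ Multiset.card s := by
  rw [Multiset.map_congr rfl fun u hu => add_eq_left_iff_le.2 (h u hu), Multiset.map_const',
    Multiset.prod_replicate]

theorem mem_of_prod_map_add_eq [Nontrivial Γ] {s t : Multiset (Tmax Γ)}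
    (hcard : Multiset.card s = Multiset.card t)
    (h : ∀ y : Tmax Γ, y ≠ 0 → (s.map fun u => y + u).prod = (t.map fun u => y + u).prod)
    {M : Tmax Γ} (hM : M ∈ s) (ht : ∀ u ∈ t, u ≤ M) : M ∈ t := by
  by_contra hMt
  have hlt : ∀ u ∈ t, u < M := fun u hu => (ht u hu).lt_of_ne (ne_of_mem_of_not_mem hu hMt)
  have hM0 : M ≠ 0 := by
    obtain ⟨u, hu⟩ := Multiset.card_pos_iff_exists_mem.1
      (hcard ▸ Multiset.card_pos_iff_exists_mem.2 ⟨M, hM⟩)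
    exact ((zero_le u).trans_lt (hlt u hu)).ne'
  obtain ⟨y, hy0, hyM, hty⟩ : ∃ y, y ≠ 0 ∧ y < M ∧ ∀ u ∈ t, u ≤ y := by
    clear hcard h ht hMt
    induction t using Multiset.induction_on with
    | empty => simpa using exists_ne_zero_lt hM0
    | cons u t ih =>
      obtain ⟨y, hy0, hyM, hty⟩ := ih fun v hv => hlt v (Multiset.mem_cons_of_mem hv)
      have hu := hlt u (Multiset.mem_cons_self u t)
      refine ⟨max u y, ?_, max_lt hu hyM, ?_⟩
      · exact ((zero_lt_iff.2 hy0).trans_le (le_max_right u y)).ne'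
      · simpa using fun v hv => Or.inr (hty v hv)
  obtain ⟨s, rfl⟩ := Multiset.exists_cons_of_mem hM
  have heq : (y + M) * (s.map fun u => y + u).prod = y * y ^ Multiset.card s := by
    simpa [prod_map_add_of_le hty, ← hcard, pow_succ'] using h y hy0
  refine heq.not_gt ?_
  calc y * y ^ Multiset.card s < M * y ^ Multiset.card s :=
        mul_lt_mul_right' hyM (zero_lt_iff.2 (pow_ne_zero _ hy0))
    _ ≤ (y + M) * (s.map fun u => y + u).prod :=
      mul_le_mul' le_add_self (pow_card_le_prod_map_add s y)

theorem eq_of_prod_map_add_eq [Nontrivial Γ] {s t : Multiset (Tmax Γ)}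
    (hcard : Multiset.card s = Multiset.card t)
    (h : ∀ y : Tmax Γ, y ≠ 0 → (s.map fun u => y + u).prod = (t.map fun u => y + u).prod) :
    s = t := by
  induction hn : Multiset.card s generalizing s t with
  | zero => rw [Multiset.card_eq_zero.1 hn, Multiset.card_eq_zero.1 (hcard.symm.trans hn)]
  | succ n ih =>
    obtain ⟨M, hMs, hMt⟩ : ∃ M, M ∈ s ∧ M ∈ t := by
      obtain ⟨M, hM, hmax⟩ := (s + t).exists_max_image id
        (Multiset.card_pos.1 (by rw [Multiset.card_add]; omega))
      simp only [Multiset.mem_add] at hM hmax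
      obtain hM | hM := hM
      · exact ⟨M, hM, mem_of_prod_map_add_eq hcard h hM fun u hu => hmax u (Or.inr hu)⟩
      · exact ⟨M, mem_of_prod_map_add_eq hcard.symm (fun y hy => (h y hy).symm) hM
          fun u hu => hmax u (Or.inl hu), hM⟩
    obtain ⟨s, rfl⟩ := Multiset.exists_cons_of_mem hMs
    obtain ⟨t, rfl⟩ := Multiset.exists_cons_of_mem hMt
    rw [Multiset.card_cons] at hn
    refine congrArg (M ::ₘ ·) (ih (by simpa using hcard) (fun y hy => ?_) (by omega))
    refine mul_left_cancel₀ ((zero_lt_iff.2 hy).trans_le (le_self_add (b := M))).ne' ?_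
    simpa only [Multiset.map_cons, Multiset.prod_cons] using h y hy

end Tmax

namespace Smax

open scoped Tmax

variable {Γ : Type*} [AddCommGroup Γ] [LinearOrder Γ] [IsOrderedAddMonoid Γ]

section Arithmetic

variable {x y : Smax Γ}

theorem exists_mk (x : Smax Γ) : ∃ a b : Tmax Γ, x = mk ⟨a, b⟩ := by
  obtain ⟨⟨a, b⟩, rfl⟩ := mk_surjective x
  exact ⟨a, b, rfl⟩

theorem mk_eq_iff {a b c d : Tmax Γ} : (mk ⟨a, b⟩ : Smax Γ) = mk ⟨c, d⟩ ↔
    (a = c ∧ b = d) ∨ (b < a ∧ d < c ∧ a = c) ∨ (a < b ∧ c < d ∧ b = d) := by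
  rw [mk_eq_mk, TmaxPair.rel_iff, TmaxPair.mk.injEq]

theorem mk_add_mk (a b c d : Tmax Γ) :
    (mk ⟨a, b⟩ + mk ⟨c, d⟩ : Smax Γ) = mk ⟨max a c, max b d⟩ :=
  (map_add mk _ _).symm

theorem mk_mul_mk (a b c d : Tmax Γ) :
    (mk ⟨a, b⟩ * mk ⟨c, d⟩ : Smax Γ) = mk ⟨a * c + b * d, a * d + b * c⟩ :=
  (map_mul mk _ _).symm

theorem neg_mk_mk (a b : Tmax Γ) : (-mk ⟨a, b⟩ : Smax Γ) = mk ⟨b, a⟩ := rfl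

theorem zero_eq_mk : (0 : Smax Γ) = mk ⟨0, 0⟩ := rfl

theorem abs_mk_mk (a b : Tmax Γ) : abs Γ (mk ⟨a, b⟩) = max a b := rfl

theorem balances_mk_mk {a b c d : Tmax Γ} :
    Balances (mk ⟨a, b⟩ : Smax Γ) (mk ⟨c, d⟩) ↔ max a d = max b c :=
  balances_mk _ _

theorem isBalanced_mk_mk {a b : Tmax Γ} : IsBalanced (mk ⟨a, b⟩ : Smax Γ) ↔ a = b := by
  simp only [IsBalanced, mk_eq_iff]
  grind

theorem isSigned_mk_mk {a b : Tmax Γ} :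
    IsSigned (mk ⟨a, b⟩ : Smax Γ) ↔ a ≠ b ∨ (a = 0 ∧ b = 0) := by
  simp only [IsSigned, pos, neg_mk_mk, mk_eq_iff]
  constructor
  · rintro ⟨c, hc⟩
    have := Tmax.zero_le c
    grind
  · have ha := Tmax.zero_le a
    have hb := Tmax.zero_le b
    rintro (h | h)
    · obtain h | h := lt_or_gt_of_ne h
      · exact ⟨b, Or.inr (Or.inr (Or.inr ⟨h, ha.trans_lt h, rfl⟩))⟩
      · exact ⟨a, Or.inl (Or.inr (Or.inl ⟨h, hb.trans_lt h, rfl⟩))⟩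
    · exact ⟨0, Or.inl (Or.inl h)⟩

scoped instance : HasDistribNeg (Smax Γ) where
  neg_neg x := by
    obtain ⟨a, b, rfl⟩ := exists_mk x
    rfl
  neg_mul x y := by
    obtain ⟨a, b, rfl⟩ := exists_mk x
    obtain ⟨c, d, rfl⟩ := exists_mk y
    simp only [neg_mk_mk, mk_mul_mk, add_comm]
  mul_neg x y := by
    obtain ⟨a, b, rfl⟩ := exists_mk x
    obtain ⟨c, d, rfl⟩ := exists_mk y
    simp only [neg_mk_mk, mk_mul_mk]

scoped instance : IdemCommSemiring (Smax Γ) where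
  __ := (inferInstance : CommSemiring (Smax Γ))
  __ := IdemSemiring.ofSemiring fun x : Smax Γ => by
    obtain ⟨a, b, rfl⟩ := exists_mk x
    simp only [mk_add_mk, max_self]

@[simp] theorem abs_neg (x : Smax Γ) : abs Γ (-x) = abs Γ x := by
  obtain ⟨a, b, rfl⟩ := exists_mk x
  simp only [neg_mk_mk, abs_mk_mk, max_comm]

@[simp] theorem abs_pos (c : Tmax Γ) : abs Γ (pos c) = c := max_eq_left (Tmax.zero_le c)

@[simp] theorem abs_eq_zero : abs Γ x = 0 ↔ x = 0 := by
  refine ⟨fun h => ?_, fun h => by rw [h, map_zero]⟩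
  obtain ⟨a, b, rfl⟩ := exists_mk x
  have hle : max a b ≤ 0 := h.le
  rw [nonpos_iff_eq_zero.1 ((le_max_left a b).trans hle),
    nonpos_iff_eq_zero.1 ((le_max_right a b).trans hle), zero_eq_mk]

instance : NoZeroDivisors (Smax Γ) where
  eq_zero_or_eq_zero_of_mul_eq_zero h := by
    rwa [← abs_eq_zero, map_mul, mul_eq_zero, abs_eq_zero, abs_eq_zero] at h

instance : Nontrivial (Smax Γ) := (abs Γ).domain_nontrivial

theorem isSigned_pos (c : Tmax Γ) : IsSigned (pos c : Smax Γ) := ⟨c, Or.inl rfl⟩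

theorem isSigned_zero : IsSigned (0 : Smax Γ) := isSigned_pos 0

theorem isSigned_one : IsSigned (1 : Smax Γ) := isSigned_pos 1

theorem pos_mul_pos (a b : Tmax Γ) : (pos a * pos b : Smax Γ) = pos (a * b) := by
  simp [pos, mk_mul_mk]

namespace IsSigned

theorem neg (hx : IsSigned x) : IsSigned (-x) := by
  obtain ⟨c, rfl | rfl⟩ := hx
  · exact ⟨c, Or.inr rfl⟩
  · exact ⟨c, Or.inl (neg_neg _)⟩

theorem mul (hx : IsSigned x) (hy : IsSigned y) : IsSigned (x * y) := by
  obtain ⟨a, rfl | rfl⟩ := hx <;> obtain ⟨b, rfl | rfl⟩ := hy <;>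
    simp only [neg_mul, mul_neg, pos_mul_pos, neg_neg, (isSigned_pos _).neg, isSigned_pos]

theorem pow (hx : IsSigned x) (k : ℕ) : IsSigned (x ^ k) := by
  induction k with
  | zero => simpa using isSigned_one
  | succ k ih => simpa [pow_succ] using ih.mul hx

theorem exists_mul_eq_one (hx : IsSigned x) (h0 : x ≠ 0) :
    ∃ y : Smax Γ, IsSigned y ∧ x * y = 1 := by
  have hpos {a : Tmax Γ} (ha : a ≠ 0) : (pos a * pos a⁻¹ : Smax Γ) = 1 := by
    rw [pos_mul_pos, mul_inv_cancel₀ ha]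
    rfl
  obtain ⟨a, ha⟩ := hx
  have ha0 : a ≠ 0 := by
    obtain rfl | rfl := ha <;> simpa [← abs_eq_zero] using h0
  obtain rfl | rfl := ha
  · exact ⟨pos a⁻¹, isSigned_pos _, hpos ha0⟩
  · exact ⟨-pos a⁻¹, (isSigned_pos _).neg, by rw [neg_mul_neg, hpos ha0]⟩

theorem add_eq_left (hx : IsSigned x) (h : abs Γ y < abs Γ x) : x + y = x := by
  obtain ⟨a, b, rfl⟩ := exists_mk x
  obtain ⟨c, d, rfl⟩ := exists_mk y
  have := Tmax.zero_le c
  rw [isSigned_mk_mk] at hx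
  rw [abs_mk_mk, abs_mk_mk] at h
  rw [mk_add_mk, mk_eq_iff]
  grind

theorem eq_or_eq_neg (hx : IsSigned x) (hy : IsSigned y) (h : abs Γ x = abs Γ y) :
    x = y ∨ x = -y := by
  obtain ⟨a, rfl | rfl⟩ := hx <;> obtain ⟨b, rfl | rfl⟩ := hy <;>
    simp only [abs_neg, abs_pos] at h <;> subst h <;> simp

theorem add (hx : IsSigned x) (hy : IsSigned y) (h : abs Γ x ≠ abs Γ y) : IsSigned (x + y) := by
  obtain hlt | hlt := lt_or_gt_of_ne h
  · rwa [add_comm, hy.add_eq_left hlt]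
  · rwa [hx.add_eq_left hlt]

theorem add_neg (hx : IsSigned x) (hy : IsSigned y) (h : x ≠ y) : IsSigned (x + -y) := by
  by_cases habs : abs Γ x = abs Γ y
  · rwa [← (hx.eq_or_eq_neg hy habs).resolve_left h, add_idem]
  · exact hx.add hy.neg (by rwa [abs_neg])

theorem eq_zero_of_isBalanced (hx : IsSigned x) (h : IsBalanced x) : x = 0 := by
  obtain ⟨a, b, rfl⟩ := exists_mk x
  rw [isSigned_mk_mk] at hx
  rw [isBalanced_mk_mk] at h
  rw [zero_eq_mk, mk_eq_iff]
  grind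

end IsSigned

theorem isBalanced_add_neg_self (x : Smax Γ) : IsBalanced (x + -x) := by
  obtain ⟨a, b, rfl⟩ := exists_mk x
  rw [neg_mk_mk, mk_add_mk, isBalanced_mk_mk, max_comm]

theorem IsBalanced.mul_right (hx : IsBalanced x) (y : Smax Γ) : IsBalanced (x * y) := by
  obtain ⟨a, rfl⟩ := hx
  obtain ⟨c, d, rfl⟩ := exists_mk y
  rw [mk_mul_mk, isBalanced_mk_mk, add_comm]

theorem IsBalanced.add_eq_left (hx : IsBalanced x) (h : abs Γ y ≤ abs Γ x) : x + y = x := by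
  obtain ⟨a, rfl⟩ := hx
  obtain ⟨c, d, rfl⟩ := exists_mk y
  rw [abs_mk_mk, abs_mk_mk] at h
  rw [mk_add_mk, mk_eq_iff]
  grind

theorem balances_zero_iff : Balances x 0 ↔ IsBalanced x := by
  obtain ⟨a, b, rfl⟩ := exists_mk x
  rw [zero_eq_mk, balances_mk_mk, isBalanced_mk_mk, max_eq_left (Tmax.zero_le a),
    max_eq_left (Tmax.zero_le b)]

theorem Balances.refl (x : Smax Γ) : Balances x x := by
  obtain ⟨a, b, rfl⟩ := exists_mk x
  rw [balances_mk_mk, max_comm]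

theorem Balances.eq_of_isSigned (h : Balances x y) (hx : IsSigned x) (hy : IsSigned y) :
    x = y := by
  obtain ⟨a, b, rfl⟩ := exists_mk x
  obtain ⟨c, d, rfl⟩ := exists_mk y
  have := Tmax.zero_le a
  have := Tmax.zero_le b
  have := Tmax.zero_le c
  have := Tmax.zero_le d
  rw [isSigned_mk_mk] at hx hy
  rw [balances_mk_mk] at h
  rw [mk_eq_iff]
  grind

theorem Balances.abs_le_of_isSigned (h : Balances x y) (hx : IsSigned x) :
    abs Γ x ≤ abs Γ y := by
  obtain ⟨a, b, rfl⟩ := exists_mk x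
  obtain ⟨c, d, rfl⟩ := exists_mk y
  have := Tmax.zero_le c
  have := Tmax.zero_le d
  rw [isSigned_mk_mk] at hx
  rw [balances_mk_mk] at h
  rw [abs_mk_mk, abs_mk_mk]
  grind

end Arithmetic

section RootProducts

theorem add_neg_ne_zero {x y : Smax Γ} (h : x ≠ y) : x + -y ≠ 0 := by
  intro h0
  have habs : abs Γ x + abs Γ y = 0 := by simpa using congrArg (abs Γ) h0
  have hx : abs Γ x = 0 := nonpos_iff_eq_zero.1 (habs ▸ le_self_add)
  have hy : abs Γ y = 0 := nonpos_iff_eq_zero.1 (habs ▸ le_add_self)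
  exact h ((abs_eq_zero.1 hx).trans (abs_eq_zero.1 hy).symm)

theorem isSigned_prod {ι : Type*} {s : Finset ι} {u : ι → Smax Γ} (hu : ∀ i, IsSigned (u i)) :
    IsSigned (∏ i ∈ s, u i) :=
  Finset.prod_induction _ _ (fun _ _ => IsSigned.mul) isSigned_one fun i _ => hu i

theorem isSigned_multiset_prod {s : Multiset (Smax Γ)} (hs : ∀ x ∈ s, IsSigned x) :
    IsSigned s.prod :=
  Multiset.prod_induction _ _ (fun _ _ => IsSigned.mul) isSigned_one hs

theorem isAbsorbing_of_antitone_abs {n : ℕ} {u : Fin n → Smax Γ} (hu : ∀ i, IsSigned (u i))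
    (hanti : Antitone (abs Γ ∘ u)) (hinj : ∀ i j, abs Γ (u i) = abs Γ (u j) → u i = u j) :
    IsAbsorbing u := by
  intro i j hij
  obtain hlt | heq := (hanti hij.le).lt_or_eq
  · exact (hu i).add_eq_left hlt
  · rw [hinj j i heq, add_idem]

/-- The formal polynomial `a (Y ⊖ r₁) ⋯ (Y ⊖ r_n)`, where `s` is the multiset of the `r_i`. -/
noncomputable def rootProd (a : Smax Γ) (s : Multiset (Smax Γ)) : (Smax Γ)[X] :=
  C a * (s.map fun r => X + C (-r)).prod

theorem rootProd_cons (a x : Smax Γ) (s : Multiset (Smax Γ)) :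
    rootProd a (x ::ₘ s) = (X + C (-x)) * rootProd a s := by
  rw [rootProd, Multiset.map_cons, Multiset.prod_cons, mul_left_comm, rootProd]

theorem rootProd_map_univ {n : ℕ} (a : Smax Γ) (r : Fin n → Smax Γ) :
    rootProd a (Finset.univ.val.map r) = C a * ∏ i, (X + C (-r i)) := by
  rw [rootProd, Multiset.map_map]
  rfl

theorem eval_rootProd (a y : Smax Γ) (s : Multiset (Smax Γ)) :
    (rootProd a s).eval y = a * (s.map fun r => y + -r).prod := by
  simp [rootProd, eval_multiset_prod]

theorem isRoot_rootProd_iff {a y : Smax Γ} {s : Multiset (Smax Γ)} (ha : IsTangible a)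
    (hs : ∀ r ∈ s, IsSigned r) : IsRoot (rootProd a s) y ↔ y ∈ s := by
  rw [IsRoot, balances_zero_iff, eval_rootProd]
  constructor
  · rintro ⟨hy, hbal⟩
    by_contra hys
    have hne : ∀ r ∈ s, y ≠ r := fun r hr h => hys (h ▸ hr)
    have hsigned : IsSigned (s.map fun r => y + -r).prod :=
      isSigned_multiset_prod (by simpa using fun r hr => hy.add_neg (hs r hr) (hne r hr))
    refine mul_ne_zero ha.2 (Multiset.prod_ne_zero ?_)
      ((ha.1.mul hsigned).eq_zero_of_isBalanced hbal)
    simpa using fun r hr => add_neg_ne_zero (hne r hr)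
  · intro hys
    refine ⟨hs y hys, ?_⟩
    obtain ⟨t, rfl⟩ := Multiset.exists_cons_of_mem hys
    rw [Multiset.map_cons, Multiset.prod_cons, mul_left_comm]
    exact (isBalanced_add_neg_self y).mul_right _

theorem isSignedPoly_rootProd {a : Smax Γ} {s : Multiset (Smax Γ)} (ha : IsSigned a)
    (hs : ∀ r ∈ s, IsSigned r) (hinj : Set.InjOn (abs Γ) {r | r ∈ s}) :
    IsSignedPoly (rootProd a s) := by
  obtain ⟨n, hn⟩ : ∃ n, Multiset.card s = n := ⟨_, rfl⟩
  obtain ⟨r, rfl, hanti⟩ := exists_antitone_comp_map_univ_eq (abs Γ) hn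
  have hmem : ∀ i, r i ∈ Finset.univ.val.map r := fun i =>
    Multiset.mem_map_of_mem r (Finset.mem_univ_val i)
  have habs : IsAbsorbing fun i => -r i :=
    isAbsorbing_of_antitone_abs (fun i => (hs _ (hmem i)).neg)
      (fun i j hij => by simpa using hanti hij)
      fun i j hij => by rw [hinj (hmem i) (hmem j) (by simpa using hij)]
  intro k
  rw [rootProd_map_univ, coeff_C_mul]
  refine ha.mul ?_
  obtain hk | hk := le_or_gt k n
  · rw [← Nat.sub_sub_self hk, habs.coeff_prod_X_add_C (Nat.sub_le _ _)]
    exact isSigned_prod fun i => (hs _ (hmem i)).neg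
  · rw [coeff_eq_zero_of_natDegree_lt ((natDegree_prod_X_add_C_le _).trans_lt hk)]
    exact isSigned_zero

theorem multGE_rootProd {a x : Smax Γ} {s : Multiset (Smax Γ)} {k : ℕ} (ha : IsTangible a)
    (hs : ∀ r ∈ s, IsSigned r) (hinj : Set.InjOn (abs Γ) {r | r ∈ s})
    (hk : Multiset.replicate k x ≤ s) : MultGE x (rootProd a s) k := by
  induction k generalizing s with
  | zero => exact MultGE.zero _
  | succ k ih =>
    obtain ⟨t, rfl⟩ := Multiset.le_iff_exists_add.1 hk
    rw [Multiset.replicate_succ, Multiset.cons_add] at hs hinj ⊢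
    set q := Multiset.replicate k x + t
    have hsub : ∀ r ∈ q, r ∈ x ::ₘ q := fun r => Multiset.mem_cons_of_mem
    have hq : ∀ r ∈ q, IsSigned r := fun r hr => hs r (hsub r hr)
    refine MultGE.succ _ (rootProd a q) k
      ((isRoot_rootProd_iff ha hs).2 (Multiset.mem_cons_self x q))
      ⟨isSignedPoly_rootProd ha.1 hq (hinj.mono hsub), 1, ⟨isSigned_one, one_ne_zero⟩, ?_⟩
      (ih hq (hinj.mono hsub) (Multiset.le_add_right _ _))
    rw [C_1, one_mul, ← rootProd_cons]
    exact fun j => Balances.refl _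

end RootProducts

section MultiplicityBounds

variable {P Q : (Smax Γ)[X]} {x : Smax Γ}

theorem absPoly_ne_zero (hP : P ≠ 0) : absPoly P ≠ 0 := by
  contrapose! hP
  ext k
  rw [coeff_zero, ← abs_eq_zero, ← coeff_map, ← absPoly, hP, coeff_zero]

theorem absPoly_mul (P Q : (Smax Γ)[X]) : absPoly (P * Q) = absPoly P * absPoly Q :=
  Polynomial.map_mul (abs Γ)

theorem absPoly_X_add_C_neg (x : Smax Γ) : absPoly (X + C (-x)) = X + C (abs Γ x) := by
  simp [absPoly]

theorem abs_eval (P : (Smax Γ)[X]) (x : Smax Γ) :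
    abs Γ (P.eval x) = (absPoly P).eval (abs Γ x) := by
  rw [absPoly, eval_map, ← eval₂_hom]

theorem abs_coeff_mul_pow (P : (Smax Γ)[X]) (x : Smax Γ) (k : ℕ) :
    abs Γ (P.coeff k * x ^ k) = (absPoly P).coeff k * abs Γ x ^ k := by
  rw [map_mul, map_pow, absPoly, coeff_map]

theorem isDominant_absPoly_iff {k : ℕ} : Tmax.IsDominant (absPoly P) (abs Γ x) k ↔
    abs Γ (P.coeff k * x ^ k) = abs Γ (P.eval x) := by
  rw [Tmax.IsDominant, abs_eval, abs_coeff_mul_pow]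

theorem eval_eq_of_forall_isDominant_eq (hP : IsSignedPoly P) (hP0 : P ≠ 0) (hx : IsTangible x)
    {i : ℕ} (hi : Tmax.IsDominant (absPoly P) (abs Γ x) i)
    (huniq : ∀ j, Tmax.IsDominant (absPoly P) (abs Γ x) j → j = i) :
    P.eval x = P.coeff i * x ^ i := by
  have heval : abs Γ (P.eval x) ≠ 0 := by
    rw [abs_eval]
    exact Tmax.eval_ne_zero (absPoly_ne_zero hP0) (abs_eq_zero.not.2 hx.2)
  rw [isDominant_absPoly_iff] at hi
  have hi0 : i ∈ P.support := by
    rw [mem_support_iff]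
    rintro h
    rw [h, zero_mul, map_zero] at hi
    exact heval hi.symm
  rw [eval_eq_sum, sum_def, ← Finset.add_sum_erase _ _ hi0]
  refine ((hP i).mul (hx.1.pow i)).add_eq_left ?_
  rw [map_sum, sum_eq_sup, hi, Finset.sup_lt_iff (zero_lt_iff.2 heval)]
  intro j hj
  refine lt_of_le_of_ne ?_ fun h =>
    (Finset.ne_of_mem_erase hj) (huniq j (isDominant_absPoly_iff.2 h))
  rw [abs_coeff_mul_pow, abs_eval]
  exact coeff_mul_pow_le_eval _ _ j

theorem IsRoot.exists_isDominant_lt (hroot : IsRoot P x) (hP : IsSignedPoly P) (hP0 : P ≠ 0)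
    (hx : x ≠ 0) : ∃ i j, Tmax.IsDominant (absPoly P) (abs Γ x) i ∧
      Tmax.IsDominant (absPoly P) (abs Γ x) j ∧ i < j := by
  obtain ⟨i, hi⟩ := Tmax.exists_isDominant (absPoly P) (abs Γ x)
  obtain ⟨j, hj, hij⟩ : ∃ j, Tmax.IsDominant (absPoly P) (abs Γ x) j ∧ j ≠ i := by
    by_contra! huniq
    have heval := eval_eq_of_forall_isDominant_eq hP hP0 ⟨hroot.1, hx⟩ hi huniq
    have hzero : P.eval x = 0 := by
      refine IsSigned.eq_zero_of_isBalanced ?_ (balances_zero_iff.1 hroot.2)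
      rw [heval]
      exact (hP i).mul (hroot.1.pow i)
    refine Tmax.eval_ne_zero (absPoly_ne_zero hP0) (abs_eq_zero.not.2 hx) ?_
    rw [← abs_eval, hzero, map_zero]
  obtain hlt | hlt := lt_or_gt_of_ne hij
  · exact ⟨j, i, hj, hi, hlt⟩
  · exact ⟨i, j, hi, hj, hlt⟩

theorem isSigned_coeff_succ_X_add_C_neg_mul (hQ : IsSignedPoly Q) (hx : IsSigned x) {k : ℕ}
    (h : ¬ (Tmax.IsDominant (absPoly Q) (abs Γ x) (k + 1) ↔
      Tmax.IsDominant (absPoly Q) (abs Γ x) k)) :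
    IsSigned (((X + C (-x)) * Q).coeff (k + 1)) := by
  rw [add_mul, coeff_add, coeff_X_mul, coeff_C_mul]
  refine (hQ k).add (hx.neg.mul (hQ (k + 1))) fun habs => h ?_
  refine Tmax.isDominant_succ_iff_of_coeff_eq ?_
  simpa [absPoly] using habs

theorem IsQuotientBy.ne_zero (h : IsQuotientBy x P Q) (hP : IsSignedPoly P) (hP0 : P ≠ 0) :
    Q ≠ 0 := by
  rintro rfl
  obtain ⟨-, l, hl, hbal⟩ := h
  refine hP0 (Polynomial.ext fun k => ?_)
  have hbal := hbal k
  rw [mul_zero, coeff_C_mul, coeff_zero] at hbal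
  simpa [hl.2] using hbal.eq_of_isSigned (hl.1.mul (hP k)) isSigned_zero

theorem IsQuotientBy.isDominant (h : IsQuotientBy x P Q) (hP : IsSignedPoly P) (hx : x ≠ 0) {k : ℕ}
    (hk : Tmax.IsDominant (absPoly Q) (abs Γ x) k ∨
      ∃ j, k = j + 1 ∧ Tmax.IsDominant (absPoly Q) (abs Γ x) j)
    (hsigned : IsSigned (((X + C (-x)) * Q).coeff k)) :
    Tmax.IsDominant (absPoly P) (abs Γ x) k := by
  obtain ⟨-, l, hl, hbal⟩ := h
  have hlP : IsSignedPoly (C l * P) := fun j => by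
    rw [coeff_C_mul]
    exact hl.1.mul (hP j)
  have hR : Tmax.IsDominant (absPoly ((X + C (-x)) * Q)) (abs Γ x) k := by
    rwa [absPoly_mul, absPoly_X_add_C_neg,
      Tmax.isDominant_X_add_C_mul_iff (abs_eq_zero.not.2 hx)]
  have hS : Tmax.IsDominant (absPoly (C l * P)) (abs Γ x) k := by
    refine hR.of_coeff_le (fun j => ?_) ?_
    · simpa only [absPoly, coeff_map] using (hbal j).abs_le_of_isSigned (hlP j)
    · rw [absPoly, absPoly, coeff_map, coeff_map, (hbal k).eq_of_isSigned (hlP k) hsigned]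
  rwa [absPoly_mul, absPoly, map_C, Tmax.isDominant_C_mul_iff (abs_eq_zero.not.2 hl.2)] at hS

theorem IsQuotientBy.exists_le_isDominant (h : IsQuotientBy x P Q) (hP : IsSignedPoly P)
    (hx : IsTangible x) {i : ℕ} (hi : Tmax.IsDominant (absPoly Q) (abs Γ x) i) :
    ∃ i' ≤ i, Tmax.IsDominant (absPoly P) (abs Γ x) i' := by
  induction i with
  | zero =>
    refine ⟨0, le_rfl, h.isDominant hP hx.2 (Or.inl hi) ?_⟩
    simpa [add_mul] using hx.1.neg.mul (h.1 0)
  | succ i ih =>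
    by_cases hi' : Tmax.IsDominant (absPoly Q) (abs Γ x) i
    · obtain ⟨i', hle, hdom⟩ := ih hi'
      exact ⟨i', hle.trans i.le_succ, hdom⟩
    · exact ⟨i + 1, le_rfl, h.isDominant hP hx.2 (Or.inl hi)
        (isSigned_coeff_succ_X_add_C_neg_mul h.1 hx.1 fun hiff => hi' (hiff.1 hi))⟩

theorem IsQuotientBy.exists_lt_isDominant (h : IsQuotientBy x P Q) (hP : IsSignedPoly P)
    (hP0 : P ≠ 0) (hx : IsTangible x) {j : ℕ} (hj : Tmax.IsDominant (absPoly Q) (abs Γ x) j) :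
    ∃ j' > j, Tmax.IsDominant (absPoly P) (abs Γ x) j' := by
  by_contra! hno
  have hall : ∀ m ≥ j, Tmax.IsDominant (absPoly Q) (abs Γ x) m := by
    intro m hm
    induction m, hm using Nat.le_induction with
    | base => exact hj
    | succ m hm ih =>
      by_contra hm'
      exact hno (m + 1) (Nat.lt_succ_of_le hm) (h.isDominant hP hx.2 (Or.inr ⟨m, rfl, ih⟩)
        (isSigned_coeff_succ_X_add_C_neg_mul h.1 hx.1 fun hiff => hm' (hiff.2 ih)))
  refine (hall (max j ((absPoly Q).natDegree + 1)) (le_max_left _ _)).coeff_ne_zero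
    (absPoly_ne_zero (h.ne_zero hP hP0)) (abs_eq_zero.not.2 hx.2) ?_
  exact coeff_eq_zero_of_natDegree_lt (Nat.lt_of_succ_le (le_max_right _ _))

theorem MultGE.exists_isDominant {k : ℕ} (h : MultGE x P k) (hP : IsSignedPoly P) (hP0 : P ≠ 0)
    (hx : IsTangible x) : ∃ i j, Tmax.IsDominant (absPoly P) (abs Γ x) i ∧
      Tmax.IsDominant (absPoly P) (abs Γ x) j ∧ i + k ≤ j := by
  induction h with
  | zero P =>
    obtain ⟨i, hi⟩ := Tmax.exists_isDominant (absPoly P) (abs Γ x)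
    exact ⟨i, i, hi, hi, le_rfl⟩
  | one P hroot => exact hroot.exists_isDominant_lt hP hP0 hx.2
  | succ P Q k _ hQ _ ih =>
    obtain ⟨i, j, hi, hj, hij⟩ := ih hQ.1 (hQ.ne_zero hP hP0)
    obtain ⟨i', hi', hdomi⟩ := hQ.exists_le_isDominant hP hx hi
    obtain ⟨j', hj', hdomj⟩ := hQ.exists_lt_isDominant hP hP0 hx hj
    exact ⟨i', j', hdomi, hdomj, by omega⟩

theorem MultGE.coeff_eq_zero {k : ℕ} (h : MultGE 0 P k) (hP : IsSignedPoly P) {j : ℕ}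
    (hj : j < k) : P.coeff j = 0 := by
  induction h generalizing j with
  | zero P => omega
  | one P hroot =>
    obtain rfl : j = 0 := by omega
    rw [coeff_zero_eq_eval_zero]
    refine IsSigned.eq_zero_of_isBalanced ?_ (balances_zero_iff.1 hroot.2)
    rw [← coeff_zero_eq_eval_zero]
    exact hP 0
  | succ P Q k _ hQ _ ih =>
    obtain ⟨hQs, l, hl, hbal⟩ := hQ
    have hXQ : (X * Q).coeff j = 0 := by
      obtain _ | j := j
      · rw [coeff_X_mul_zero]
      · rw [coeff_X_mul, ih hQs (by omega)]
    have hbalj : Balances (l * P.coeff j) 0 := by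
      simpa [coeff_C_mul, hXQ] using hbal j
    exact (mul_eq_zero.1 (hbalj.eq_of_isSigned (hl.1.mul (hP j)) isSigned_zero)).resolve_left hl.2

end MultiplicityBounds

section Factorizations

variable {P : (Smax Γ)[X]} {s t : Multiset (Smax Γ)}

theorem isTangible_leadingCoeff (hP : IsSignedPoly P) (hP0 : P ≠ 0) :
    IsTangible P.leadingCoeff :=
  ⟨hP P.natDegree, leadingCoeff_ne_zero.2 hP0⟩

theorem IsFactorization.isRoot_iff_mem (hs : IsFactorization P s) (hP : IsSignedPoly P)
    (hP0 : P ≠ 0) {x : Smax Γ} : IsRoot P x ↔ x ∈ s := by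
  rw [← isRoot_rootProd_iff (isTangible_leadingCoeff hP hP0) hs.1, IsRoot, IsRoot, hs.2.2,
    eval_rootProd]

theorem IsFactorization.unique [Nontrivial Γ] (hs : IsFactorization P s)
    (ht : IsFactorization P t) (hP : IsSignedPoly P) (hP0 : P ≠ 0)
    (hinj : Set.InjOn (abs Γ) {r | r ∈ t}) : s = t := by
  have hprod : ∀ {q : Multiset (Smax Γ)}, IsFactorization P q → ∀ y : Tmax Γ,
      abs Γ P.leadingCoeff * ((q.map (abs Γ)).map fun u => y + u).prod =
        abs Γ (P.eval (pos y)) := by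
    intro q hq y
    rw [hq.2.2, map_mul, map_multiset_prod, Multiset.map_map, Multiset.map_map]
    simp
  refine eq_of_map_eq_map_of_injOn hinj
    (fun x hx => (ht.isRoot_iff_mem hP hP0).1 ((hs.isRoot_iff_mem hP hP0).2 hx)) ?_
  refine Tmax.eq_of_prod_map_add_eq ?_ fun y _ => ?_
  · rw [Multiset.card_map, Multiset.card_map, hs.2.1, ht.2.1]
  · exact mul_left_cancel₀ (abs_eq_zero.not.2 (leadingCoeff_ne_zero.2 hP0))
      ((hprod hs y).trans (hprod ht y).symm)

end Factorizations

section RootSequences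

variable {P : (Smax Γ)[X]}

theorem natDegree_absPoly (P : (Smax Γ)[X]) : (absPoly P).natDegree = P.natDegree := by
  obtain rfl | hP := eq_or_ne P 0
  · rw [absPoly, Polynomial.map_zero, natDegree_zero, natDegree_zero]
  · exact natDegree_map_of_leadingCoeff_ne_zero _ (abs_eq_zero.not.2 (leadingCoeff_ne_zero.2 hP))

theorem exists_antitone_of_isFactored (hfac : Tmax.IsFactored (absPoly P)) :
    ∃ c : Fin P.natDegree → Tmax Γ, Antitone c ∧ ∀ i : Fin P.natDegree,
      abs Γ (P.coeff (P.natDegree - (i + 1))) = c i * abs Γ (P.coeff (P.natDegree - i)) := by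
  have h := hfac.exists_antitone
  rw [natDegree_absPoly] at h
  simpa only [absPoly, coeff_map] using h

theorem coeff_ne_zero_of_isFactored (hfac : Tmax.IsFactored (absPoly P)) (hP0 : P ≠ 0) {i : ℕ}
    (hi : i ≤ P.natDegree - P.natTrailingDegree) : P.coeff (P.natDegree - i) ≠ 0 := by
  obtain ⟨c, -, hc⟩ := exists_antitone_of_isFactored hfac
  intro h0
  have hzero : ∀ t, i ≤ t → t ≤ P.natDegree → P.coeff (P.natDegree - t) = 0 := by
    intro t hit
    induction t, hit using Nat.le_induction with
    | base => exact fun _ => h0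
    | succ t _ ih =>
      intro ht
      have hct := hc ⟨t, ht⟩
      rwa [ih (by omega), map_zero, mul_zero, abs_eq_zero] at hct
  have htrailing := hzero _ hi (Nat.sub_le _ _)
  rw [Nat.sub_sub_self P.natTrailingDegree_le_natDegree] at htrailing
  exact hP0 (trailingCoeff_eq_zero.1 htrailing)

theorem existsUnique_isRootSequence (hP : IsSignedPoly P) (hP0 : P ≠ 0)
    (hfac : Tmax.IsFactored (absPoly P)) :
    ∃! r : Fin P.natDegree → Smax Γ, IsRootSequence P r := by
  have hterm : ∀ i : Fin P.natDegree, ∃! x : Smax Γ, IsSigned x ∧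
      ((i : ℕ) + 1 ≤ P.natDegree - P.natTrailingDegree →
        x * P.coeff (P.natDegree - i) = -P.coeff (P.natDegree - (i + 1))) ∧
      (P.natDegree - P.natTrailingDegree < (i : ℕ) + 1 → x = 0) := by
    intro i
    obtain hi | hi := le_or_gt ((i : ℕ) + 1) (P.natDegree - P.natTrailingDegree)
    · have hne : P.coeff (P.natDegree - i) ≠ 0 := coeff_ne_zero_of_isFactored hfac hP0 (by omega)
      obtain ⟨w, hw, hmul⟩ := (hP (P.natDegree - i)).exists_mul_eq_one hne
      refine ⟨-P.coeff (P.natDegree - (i + 1)) * w, ⟨(hP _).neg.mul hw, fun _ => ?_, ?_⟩, ?_⟩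
      · rw [mul_assoc, mul_comm w, hmul, mul_one]
      · exact fun hi' => absurd hi' hi.not_gt
      · rintro x ⟨-, hx, -⟩
        rw [← hx hi, mul_assoc, hmul, mul_one]
    · exact ⟨0, ⟨isSigned_zero, fun hi' => absurd hi' hi.not_ge, fun _ => rfl⟩,
        fun x hx => hx.2.2 hi⟩
  choose r hr huniq using hterm
  exact ⟨r, hr, fun r' hr' => funext fun i => huniq i (r' i) (hr' i)⟩

theorem isBalanced_eval_of_isDominant {x : Smax Γ} {i j : ℕ}
    (hi : Tmax.IsDominant (absPoly P) (abs Γ x) i)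
    (hij : P.coeff j * x ^ j = -(P.coeff i * x ^ i)) : IsBalanced (P.eval x) := by
  have hbal := isBalanced_add_neg_self (P.coeff i * x ^ i)
  have heval : P.coeff i * x ^ i + -(P.coeff i * x ^ i) + P.eval x = P.eval x := by
    rw [← hij, add_assoc, add_eq_right_iff_le.2 (coeff_mul_pow_le_eval P x j),
      add_eq_right_iff_le.2 (coeff_mul_pow_le_eval P x i)]
  rw [← heval, hbal.add_eq_left]
  · exact hbal
  · rw [map_add, abs_neg, add_idem, isDominant_absPoly_iff.1 hi]

end RootSequences

namespace IsRootSequence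

variable {P : (Smax Γ)[X]} {r : Fin P.natDegree → Smax Γ}

theorem coeff_succ (hr : IsRootSequence P r) (i : Fin P.natDegree) :
    P.coeff (P.natDegree - (i + 1)) = -r i * P.coeff (P.natDegree - i) := by
  obtain hi | hi := le_or_gt ((i : ℕ) + 1) (P.natDegree - P.natTrailingDegree)
  · rw [neg_mul, (hr i).2.1 hi, neg_neg]
  · rw [(hr i).2.2 hi, neg_zero, zero_mul]
    exact coeff_eq_zero_of_lt_natTrailingDegree (by omega)

theorem antitone_abs (hr : IsRootSequence P r) (hfac : Tmax.IsFactored (absPoly P))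
    (hP0 : P ≠ 0) : Antitone (abs Γ ∘ r) := by
  obtain ⟨c, hc, hcP⟩ := exists_antitone_of_isFactored hfac
  have heq : ∀ i : Fin P.natDegree, (i : ℕ) + 1 ≤ P.natDegree - P.natTrailingDegree →
      abs Γ (r i) = c i := by
    intro i hi
    have hne : P.coeff (P.natDegree - i) ≠ 0 := coeff_ne_zero_of_isFactored hfac hP0 (by omega)
    refine mul_right_cancel₀ (abs_eq_zero.not.2 hne) ?_
    rw [← hcP, hr.coeff_succ, map_mul, abs_neg]
  intro i j hij
  simp only [Function.comp_apply]
  obtain hj | hj := le_or_gt ((j : ℕ) + 1) (P.natDegree - P.natTrailingDegree)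
  · rw [heq i ((Nat.succ_le_succ hij).trans hj), heq j hj]
    exact hc hij
  · rw [(hr j).2.2 hj, map_zero]
    exact Tmax.zero_le _

theorem absPoly_eq (hr : IsRootSequence P r) (hanti : Antitone (abs Γ ∘ r)) :
    absPoly P = C (abs Γ P.leadingCoeff) * ∏ i, (X + C (abs Γ (r i))) := by
  have h := (Tmax.isAbsorbing_iff_antitone.2 hanti).eq_C_mul_prod_X_add_C (P := absPoly P)
    (natDegree_absPoly P).le fun i => by
      rw [absPoly, coeff_map, coeff_map, hr.coeff_succ, map_mul, abs_neg, Function.comp_apply]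
  rwa [absPoly, coeff_map] at h

theorem isDominant_iff (hr : IsRootSequence P r) (hanti : Antitone (abs Γ ∘ r)) (hP0 : P ≠ 0)
    {x : Smax Γ} (hx : x ≠ 0) {t : ℕ} (ht : t ≤ P.natDegree) :
    Tmax.IsDominant (absPoly P) (abs Γ x) (P.natDegree - t) ↔ ∀ i : Fin P.natDegree,
      if i.val < t then abs Γ x ≤ abs Γ (r i) else abs Γ (r i) ≤ abs Γ x := by
  rw [hr.absPoly_eq hanti]
  exact Tmax.isDominant_prod_iff hanti (abs_eq_zero.not.2 (leadingCoeff_ne_zero.2 hP0))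
    (abs_eq_zero.not.2 hx) ht

theorem isDominant_sub_val (hr : IsRootSequence P r) (hanti : Antitone (abs Γ ∘ r))
    (hP0 : P ≠ 0) {i : Fin P.natDegree} (hi : r i ≠ 0) :
    Tmax.IsDominant (absPoly P) (abs Γ (r i)) (P.natDegree - i) := by
  refine (hr.isDominant_iff hanti hP0 hi i.isLt.le).2 fun j => ?_
  split_ifs with hj
  exacts [hanti (Fin.le_def.2 hj.le), hanti (Fin.le_def.2 (not_lt.1 hj))]

theorem isDominant_sub_succ (hr : IsRootSequence P r) (hanti : Antitone (abs Γ ∘ r))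
    (hP0 : P ≠ 0) {i : Fin P.natDegree} (hi : r i ≠ 0) :
    Tmax.IsDominant (absPoly P) (abs Γ (r i)) (P.natDegree - (i + 1)) := by
  refine (hr.isDominant_iff hanti hP0 hi i.isLt).2 fun j => ?_
  split_ifs with hj
  exacts [hanti (Fin.le_def.2 (Nat.le_of_lt_succ hj)), hanti (Fin.le_def.2 (by omega))]

theorem isCorner (hr : IsRootSequence P r) (hanti : Antitone (abs Γ ∘ r)) (hP0 : P ≠ 0)
    {i : Fin P.natDegree} (hi : r i ≠ 0) : Tmax.IsCorner (absPoly P) (abs Γ (r i)) := by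
  have habs := abs_eq_zero.not.2 hi
  have hdom := hr.isDominant_sub_val hanti hP0 hi
  have hdom' := hr.isDominant_sub_succ hanti hP0 hi
  exact Or.inl ⟨habs, _, mem_support_iff.2 (hdom.coeff_ne_zero (absPoly_ne_zero hP0) habs), _,
    mem_support_iff.2 (hdom'.coeff_ne_zero (absPoly_ne_zero hP0) habs), by omega, hdom, hdom'⟩

theorem isRoot (hr : IsRootSequence P r) (hanti : Antitone (abs Γ ∘ r)) (hP0 : P ≠ 0)
    {i : Fin P.natDegree} (hi : r i ≠ 0) : IsRoot P (r i) := by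
  refine ⟨(hr i).1, balances_zero_iff.2
    (isBalanced_eval_of_isDominant (j := P.natDegree - (i + 1))
      (hr.isDominant_sub_val hanti hP0 hi) ?_)⟩
  rw [hr.coeff_succ, show P.natDegree - i = P.natDegree - (i + 1) + 1 by omega, neg_mul, neg_mul]
  exact congrArg Neg.neg (by ring)

variable (hr : IsRootSequence P r) (hanti : Antitone (abs Γ ∘ r))
  (hinj : ∀ i j, abs Γ (r i) = abs Γ (r j) → r i = r j)

include hr hanti hinj

theorem eq_rootProd : P = rootProd P.leadingCoeff (Finset.univ.val.map r) := by
  have habs : IsAbsorbing fun i => -r i :=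
    isAbsorbing_of_antitone_abs (fun i => (hr i).1.neg)
      (fun i j hij => by simpa using hanti hij)
      fun i j hij => by rw [hinj i j (by simpa using hij)]
  rw [rootProd_map_univ]
  exact habs.eq_C_mul_prod_X_add_C le_rfl hr.coeff_succ

theorem isFactorization : IsFactorization P (Finset.univ.val.map r) := by
  refine ⟨fun x hx => ?_, by simp, fun y => ?_⟩
  · obtain ⟨i, -, rfl⟩ := Multiset.mem_map.1 hx
    exact (hr i).1
  · conv_lhs => rw [hr.eq_rootProd hanti hinj, eval_rootProd]

theorem le_natCard_of_multGE (hP : IsSignedPoly P) (hP0 : P ≠ 0) {l : Fin P.natDegree} {k : ℕ}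
    (h : MultGE (r l) P k) : k ≤ Nat.card {i // r i = r l} := by
  obtain hx | hx := eq_or_ne (r l) 0
  · have hk : k ≤ P.natTrailingDegree :=
      le_natTrailingDegree hP0 fun j hj => (hx ▸ h).coeff_eq_zero hP hj
    calc k ≤ P.natDegree - (P.natDegree - P.natTrailingDegree) := by
          rwa [Nat.sub_sub_self P.natTrailingDegree_le_natDegree]
      _ ≤ Nat.card {i // r i = r l} := sub_le_natCard_subtype le_rfl fun i hi _ =>
        ((hr i).2.2 (Nat.lt_succ_of_le hi)).trans hx.symm
  · obtain ⟨a, b, ha, hb, hab⟩ := h.exists_isDominant hP hP0 ⟨(hr l).1, hx⟩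
    have hbn : b ≤ P.natDegree := natDegree_absPoly P ▸ le_natDegree_of_ne_zero
      (hb.coeff_ne_zero (absPoly_ne_zero hP0) (abs_eq_zero.not.2 hx))
    rw [← Nat.sub_sub_self (show a ≤ P.natDegree by omega),
      hr.isDominant_iff hanti hP0 hx (Nat.sub_le _ _)] at ha
    rw [← Nat.sub_sub_self hbn, hr.isDominant_iff hanti hP0 hx (Nat.sub_le _ _)] at hb
    calc k ≤ P.natDegree - a - (P.natDegree - b) := by omega
      _ ≤ Nat.card {i // r i = r l} := sub_le_natCard_subtype (Nat.sub_le _ _) fun i hi hi' =>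
        hinj i l (le_antisymm (by simpa [hi.not_gt] using hb i) (by simpa [hi'] using ha i))

theorem mult_eq (hP : IsSignedPoly P) (hP0 : P ≠ 0) (x : Smax Γ) :
    mult x P = Nat.card {i // r i = x} := by
  classical
  have hs := hr.isFactorization hanti hinj
  by_cases hx : IsRoot P x
  · obtain ⟨l, -, rfl⟩ := Multiset.mem_map.1 ((hs.isRoot_iff_mem hP hP0).1 hx)
    refine le_antisymm (iSup₂_le fun k hk =>
      Nat.cast_le.2 (hr.le_natCard_of_multGE hanti hinj hP hP0 hk)) (MultGE.le_mult ?_)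
    have hmult := multGE_rootProd (isTangible_leadingCoeff hP hP0) hs.1
      (injOn_setOf_mem_map_univ hinj)
      (Multiset.le_count_iff_replicate_le.1 (count_map_univ r (r l)).ge)
    rwa [← hr.eq_rootProd hanti hinj] at hmult
  · rw [mult_of_not_isRoot hx, ← count_map_univ,
      Multiset.count_eq_zero.2 (mt (hs.isRoot_iff_mem hP hP0).2 hx), Nat.cast_zero]

omit hinj

theorem forall_abs_eq_iff (hP : IsSignedPoly P) (hP0 : P ≠ 0) :
    (∀ i j, abs Γ (r i) = abs Γ (r j) → r i = r j) ↔ ∀ c : Tmax Γ, c ≠ 0 →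
      Tmax.IsCorner (absPoly P) c → ¬ (IsRoot P (pos c) ∧ IsRoot P (-pos c)) := by
  constructor
  · rintro hinj c hc - ⟨hpos, hneg⟩
    have hs := hr.isFactorization hanti hinj
    have heq : pos c = -pos c := injOn_setOf_mem_map_univ hinj
      ((hs.isRoot_iff_mem hP hP0).1 hpos) ((hs.isRoot_iff_mem hP hP0).1 hneg) (abs_neg _).symm
    have hbal : IsBalanced (pos c) := by
      simpa [← heq, add_idem] using isBalanced_add_neg_self (pos c)
    refine hc ?_
    rw [← abs_pos c, (isSigned_pos c).eq_zero_of_isBalanced hbal, map_zero]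
  · intro hcorner i j hij
    obtain hi | hi := eq_or_ne (r i) 0
    · rw [hi, map_zero, eq_comm, abs_eq_zero] at hij
      rw [hi, hij]
    have hj : r j ≠ 0 := abs_eq_zero.not.1 (hij ▸ abs_eq_zero.not.2 hi)
    by_contra hne
    have hneg : r j = -r i := ((hr j).1.eq_or_eq_neg (hr i).1 hij.symm).resolve_left (Ne.symm hne)
    have hrooti := hr.isRoot hanti hP0 hi
    have hrootj := hr.isRoot hanti hP0 hj
    rw [hneg] at hrootj
    refine hcorner _ (abs_eq_zero.not.2 hi) (hr.isCorner hanti hP0 hi) ?_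
    obtain ⟨c, hc | hc⟩ := (hr i).1
    · rw [hc] at hrooti hrootj ⊢
      rw [abs_pos]
      exact ⟨hrooti, hrootj⟩
    · rw [hc] at hrooti hrootj ⊢
      rw [abs_neg, abs_pos]
      exact ⟨neg_neg (pos c) ▸ hrootj, hrooti⟩

end IsRootSequence

end Smax

theorem mainTheorem7_general {Γ : Type*} [AddCommGroup Γ] [LinearOrder Γ] [IsOrderedAddMonoid Γ]
    (P : (Smax Γ)[X]) (hP0 : P ≠ 0) (hP : Smax.IsSignedPoly P)
    (hfac : Tmax.IsFactored (Smax.absPoly P)) :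
    (∃! r : Fin P.natDegree → Smax Γ, Smax.IsRootSequence P r) ∧
    ∀ r : Fin P.natDegree → Smax Γ, Smax.IsRootSequence P r →
      ((∀ i j, Smax.abs Γ (r i) = Smax.abs Γ (r j) → r i = r j) ↔
        ∀ c : Tmax Γ, c ≠ 0 → Tmax.IsCorner (Smax.absPoly P) c →
          ¬ (Smax.IsRoot P (Smax.pos c) ∧ Smax.IsRoot P (-Smax.pos c))) ∧
      ((∀ i j, Smax.abs Γ (r i) = Smax.abs Γ (r j) → r i = r j) →
        Smax.IsFactorization P (Finset.univ.val.map r) ∧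
        (Nontrivial Γ → ∀ s : Multiset (Smax Γ), Smax.IsFactorization P s →
          s = Finset.univ.val.map r) ∧
        ∀ x : Smax Γ, Smax.mult x P = (Nat.card {i // r i = x} : ℕ∞)) := by
  refine ⟨Smax.existsUnique_isRootSequence hP hP0 hfac, fun r hr => ?_⟩
  have hanti := hr.antitone_abs hfac hP0
  refine ⟨hr.forall_abs_eq_iff hanti hP hP0, fun hinj => ?_⟩
  have hfact := hr.isFactorization hanti hinj
  exact ⟨hfact, fun _ s hs => hs.unique hfact hP hP0 (injOn_setOf_mem_map_univ hinj),
    hr.mult_eq hanti hinj hP hP0⟩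

theorem mainTheorem7 {Γ : Type*} [AddCommGroup Γ] [LinearOrder Γ] [IsOrderedAddMonoid Γ]
    (hdiv : ∀ n : ℕ, 0 < n → ∀ a : Γ, ∃ b : Γ, n • b = a)
    (P : (Smax Γ)[X]) (hP0 : P ≠ 0) (hP : Smax.IsSignedPoly P)
    (hfac : Tmax.IsFactored (Smax.absPoly P)) :
    (∃! r : Fin P.natDegree → Smax Γ, Smax.IsRootSequence P r) ∧
    ∀ r : Fin P.natDegree → Smax Γ, Smax.IsRootSequence P r →
      ((∀ i j, Smax.abs Γ (r i) = Smax.abs Γ (r j) → r i = r j) ↔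
        ∀ c : Tmax Γ, c ≠ 0 → Tmax.IsCorner (Smax.absPoly P) c →
          ¬ (Smax.IsRoot P (Smax.pos c) ∧ Smax.IsRoot P (-Smax.pos c))) ∧
      ((∀ i j, Smax.abs Γ (r i) = Smax.abs Γ (r j) → r i = r j) →
        Smax.IsFactorization P (Finset.univ.val.map r) ∧
        (Nontrivial Γ → ∀ s : Multiset (Smax Γ), Smax.IsFactorization P s →
          s = Finset.univ.val.map r) ∧
        ∀ x : Smax Γ, Smax.IsRoot P x →
          Smax.mult x P = (Nat.card {i // r i = x} : ℕ∞)) := by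
  obtain ⟨hex, h⟩ := mainTheorem7_general P hP0 hP hfac
  exact ⟨hex, fun r hr => (h r hr).imp_right fun h ha => (h ha).imp_right (And.imp_right
    fun hmult x _ => hmult x)⟩
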